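/- Let $I=[a,b]\subset\mathbb{R}$ with $a<b$, let $n\in\{0,1,2,\dots\}$, and for $x\in\mathbb{R}$ put $y=\frac{2}{b-a}\left(x-\frac{a+b}{2}\right)$. Let $T_k,U_k$ be the Chebyshev polynomials of the first and second kind. **Functions.** For $k\ge 0$ and $y\in\mathbb{R}$ let $$W_k(y)=(1-y^2)_+^{1/2}\,U_k(y),\qquad V_k(y)=(1-y^2)_+^{-1/2}\,T_k(y),$$ both being $0$ for $|y|\ge 1$; let $\tilde T_k(y)=T_k(y)$ for $|y|\le1$ and $\tilde T_k(y)=\left(y-\mathrm{sgn}(y)\sqrt{y^2-1}\right)^k$ for $|y|>1$. Let $\tilde U_{-2}(y)=\tilde U_{-1}(y)=0$ for $|y|\le 1$, and $\tilde U_{-2}(y)=-\frac{|y|}{\sqrt{y^2-1}}$, $\tilde U_{-1}(y)=-\frac{\mathrm{sgn}(y)}{\sqrt{y^2-1}}$ for $|y|>1$; further $\tilde U_0=\tilde T_0+\tilde U_{-2}$ and $\tilde U_k=2\tilde T_k+\tilde U_{k-2}$ for $k\ge1$. A superscript $I$ denotes composition with the affine map: $W_k^I(x)=W_k(y)$, and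 similarly for the other functions. The sum space and dual sum space quasimatrices are the rows of functions $$S_n^I=\left(\tilde T_0^I\,\middle|\,W_0^I\ \ \tilde T_1^I\,\middle|\,\cdots\,\middle|\,W_n^I\ \ \tilde T_{n+1}^I\right),\qquad S_n^{I,*}=\left(\tilde U_{-2}^I\,\middle|\,V_0^I\ \ \tilde U_{-1}^I\,\middle|\,\cdots\,\middle|\,V_{n+2}^I\ \ \tilde U_{n+1}^I\right).$$ **Operators** (applied columnwise). $\mathcal H[u](x)=\frac1\pi\,\mathrm{p.v.}\!\int_{\mathbb R}\frac{u(t)}{x-t}\,dt$ and $(-\Delta)^{1/2}[u](x)=c_{1/2}\,\mathrm{p.v.}\!\int_{\mathbb R}\frac{u(x)-u(t)}{|x-t|^2}\,dt$, where $c_s=\frac{4^s\Gamma(1/2+s)}{\pi^{1/2}|\Gamma(-s)|}$, so that $c_{1/2}=\frac1\pi$. Principal values are taken symmetrically around $x$ and symmetrically at infinity. **Matrices.** Let $N=\begin{pmatrix}-1&0\\0&1\end{pmatrix}$, $M=\begin{pmatrix}0&1\\1&0\end{pmatrix}$, $\mathbf e_2=\begin{pmatrix}0\\1\end{pmatrix}$.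 Define $E,H,D^I,A^I\in\mathbb R^{(2n+7)\times(2n+3)}$ by partitioning the rows as one leading row followed by two-row blocks $0,\dots,n+2$, and the columns as one leading column followed by two-column blocks $0,\dots,n$. All entries not listed are zero: * $E$ has leading entry $-1$; its leading column has $\mathbf e_2$ in row block $1$; and column block $k$ has $-\frac12N$ in row block $k$ and $\frac12N$ in row block $k+2$. * $H$: column block $k$ has $-\frac12M$ in row block $k$ and $\frac12M$ in row block $k+2$. * $D^I$: column block $k$ has $\frac{2(k+1)}{b-a}N$ in row block $k+1$. * $A^I$: column block $k$ has $\frac{2(k+1)}{b-a}M$ in row block $k+1$. **Proposition.** For every $x\in\mathbb R$, $$S_n^I(x)=S_n^{I,*}(x)E,\qquad \mathcal H[S_n^I](x)=S_n^{I,*}(x)H,$$ and for every $x\in\mathbb R\setminus\{a,b\}$, $$\frac{d}{dx}S_n^I(x)=S_n^{I,*}(x)D^I,\qquad (-\Delta)^{1/2}[S_n^I](x)=S_n^{I,*}(x)A^I.$$ In particular the principal values and the derivatives involved exist. The last identity also holds in the sense of distributions on $\mathbb R$: for each column $u$ of $S_n^I$, with corresponding entry $f$ of $S_n^{I,*}A^I$,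 and each Schwartz function $\varphi$, one has $\int_{\mathbb R} f\varphi\,dx=\int_{\mathbb R}u\,(-\Delta)^{1/2}[\varphi]\,dx$, both integrals being absolutely convergent. The matrices $E,H,D^I,A^I$ are sparse: each column has at most two nonzero entries, and the $2\times2$ block in row block $i$, column block $k$ vanishes unless $k\le i\le k+2$. -/

import Mathlib

noncomputable section

namespace SumSpace

open MeasureTheory Filter Topology Matrix

/-! ### Principal values, Hilbert transform, fractional Laplacian -/

/-- `HasPVIntegral g x l`: the Cauchy principal value integral of `g` over `ℝ`, with a possible
singularity at `x`, exists and equals `l`. The integral is truncated symmetrically around `x`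
and symmetrically at infinity. -/
def HasPVIntegral (g : ℝ → ℝ) (x l : ℝ) : Prop :=
  (∀ ε R : ℝ, 0 < ε → IntegrableOn g {y : ℝ | ε ≤ |y - x| ∧ |y| ≤ R}) ∧
    Tendsto (fun p : ℝ × ℝ => ∫ y in {y : ℝ | p.1 ≤ |y - x| ∧ |y| ≤ p.2}, g y)
      (𝓝[>] 0 ×ˢ atTop) (𝓝 l)

/-- The Hilbert transform `(1/π) p.v. ∫ u(y) / (x - y) dy` exists at `x` and equals `l`. -/
def HasHilbertTransformAt (u : ℝ → ℝ) (x l : ℝ) : Prop :=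
  ∃ J : ℝ, HasPVIntegral (fun y => u y / (x - y)) x J ∧ l = 1 / Real.pi * J

/-- The constant `4^s Γ(1/2 + s) / (π^{1/2} |Γ(-s)|)`. -/
def fracLaplacianConst (s : ℝ) : ℝ :=
  4 ^ s * Real.Gamma (1 / 2 + s) / (Real.sqrt Real.pi * |Real.Gamma (-s)|)

/-- The singular integral `(-Δ)^s u(x) = c_s p.v. ∫ (u(x) - u(y)) / |x - y|^{1+2s} dy` exists
at `x` and equals `l`. -/
def HasFracLaplacianAt (s : ℝ) (u : ℝ → ℝ) (x l : ℝ) : Prop :=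
  ∃ J : ℝ, HasPVIntegral (fun y => (u x - u y) / |x - y| ^ (1 + 2 * s)) x J ∧
    l = fracLaplacianConst s * J

/-- `(-Δ)^s u = f` in the sense of distributions, i.e. `∫ f φ = ∫ u (-Δ)^s φ` for all Schwartz
functions `φ`, where `ψ = (-Δ)^s φ` is given by the singular integral. -/
def HasDistribFracLaplacian (s : ℝ) (u f : ℝ → ℝ) : Prop :=
  ∀ φ : SchwartzMap ℝ ℝ, ∃ ψ : ℝ → ℝ,
    (∀ x, HasFracLaplacianAt s φ x (ψ x)) ∧
    Integrable (fun x => u x * ψ x) ∧ Integrable (fun x => f x * φ x) ∧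
    ∫ x, f x * φ x = ∫ x, u x * ψ x

/-! ### The four families of functions on the reference interval `[-1, 1]` -/

/-- The extended Chebyshev function of the first kind, `T̃_n`. -/
def extT (n : ℕ) (x : ℝ) : ℝ :=
  if |x| ≤ 1 then (Polynomial.Chebyshev.T ℝ n).eval x
  else (x - Real.sign x * Real.sqrt (x ^ 2 - 1)) ^ n

/-- The weighted Chebyshev polynomial of the second kind, extended by zero, `W_n`. -/
def wtW (n : ℕ) (x : ℝ) : ℝ :=
  if |x| < 1 then Real.sqrt (1 - x ^ 2) * (Polynomial.Chebyshev.U ℝ n).eval x else 0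

/-- The weighted Chebyshev polynomial of the first kind, extended by zero, `V_n`. -/
def wtV (n : ℕ) (x : ℝ) : ℝ :=
  if |x| < 1 then (Polynomial.Chebyshev.T ℝ n).eval x / Real.sqrt (1 - x ^ 2) else 0

/-- The extended Chebyshev functions of the second kind, with the index shifted by two:
`extU m` is `Ũ_{m-2}`, so that the list starts with `Ũ_{-2}, Ũ_{-1}, Ũ_0`. -/
def extU : ℕ → ℝ → ℝ
  | 0 => fun x => if |x| ≤ 1 then 0 else -(|x| / Real.sqrt (x ^ 2 - 1))
  | 1 => fun x => if |x| ≤ 1 then 0 else -(Real.sign x / Real.sqrt (x ^ 2 - 1))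
  | 2 => fun x => extT 0 x + extU 0 x
  | (k + 3) => fun x => 2 * extT (k + 1) x + extU (k + 1) x

/-! ### Quasimatrices on `I = [a, b]` -/

/-- The affine map `y = 2 / (b - a) * (x - (a + b) / 2)` from `[a, b]` onto `[-1, 1]`. -/
def toRef (a b x : ℝ) : ℝ := 2 / (b - a) * (x - (a + b) / 2)

/-- One leading index, followed by `m` blocks of two indices each. -/
abbrev BlockIdx (m : ℕ) : Type := Unit ⊕ (Fin m × Fin 2)

/-- The sum space quasimatrix `(T̃_0 | W_0 T̃_1 | ⋯ | W_n T̃_{n+1})` at `x`. -/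
def quasiS (a b : ℝ) (n : ℕ) (x : ℝ) : BlockIdx (n + 1) → ℝ :=
  Sum.elim (fun _ => extT 0 (toRef a b x))
    (fun p => ![wtW (p.1 : ℕ) (toRef a b x), extT ((p.1 : ℕ) + 1) (toRef a b x)] p.2)

/-- The dual sum space quasimatrix `(Ũ_{-2} | V_0 Ũ_{-1} | ⋯ | V_{n+2} Ũ_{n+1})` at `x`;
the `k`-th block is `V_k, Ũ_{k-1}`, and `Ũ_{k-1}` is `extU (k + 1)`. -/
def quasiSDual (a b : ℝ) (n : ℕ) (x : ℝ) : BlockIdx (n + 3) → ℝ :=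
  Sum.elim (fun _ => extU 0 (toRef a b x))
    (fun p => ![wtV (p.1 : ℕ) (toRef a b x), extU ((p.1 : ℕ) + 1) (toRef a b x)] p.2)

/-! ### The matrices -/

def matN : Matrix (Fin 2) (Fin 2) ℝ := !![-1, 0; 0, 1]

def matM : Matrix (Fin 2) (Fin 2) ℝ := !![0, 1; 1, 0]

/-- The `2p × 2q` matrix whose `2 × 2` block in block position `(i, k)` is `B i k`. -/
def ofBlocks (p q : ℕ) (B : ℕ → ℕ → Matrix (Fin 2) (Fin 2) ℝ) :
    Matrix (Fin p × Fin 2) (Fin q × Fin 2) ℝ :=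
  Matrix.of fun i k => B i.1 k.1 i.2 k.2

/-- The identity matrix operator `E`. -/
def matE (n : ℕ) : Matrix (BlockIdx (n + 3)) (BlockIdx (n + 1)) ℝ :=
  Matrix.fromBlocks
    (Matrix.of fun _ _ => -1) 0
    (Matrix.of fun i _ => if (i.1 : ℕ) = 1 then (![0, 1] : Fin 2 → ℝ) i.2 else 0)
    (ofBlocks (n + 3) (n + 1) fun i k =>
      if i = k then -((1 / 2 : ℝ) • matN) else if i = k + 2 then (1 / 2 : ℝ) • matN else 0)

/-- The Hilbert transform matrix operator `H`. -/
def matH (n : ℕ) : Matrix (BlockIdx (n + 3)) (BlockIdx (n + 1)) ℝ :=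
  Matrix.fromBlocks 0 0 0
    (ofBlocks (n + 3) (n + 1) fun i k =>
      if i = k then -((1 / 2 : ℝ) • matM) else if i = k + 2 then (1 / 2 : ℝ) • matM else 0)

/-- The derivative matrix operator `D^I`, `I = [a, b]`. -/
def matD (a b : ℝ) (n : ℕ) : Matrix (BlockIdx (n + 3)) (BlockIdx (n + 1)) ℝ :=
  Matrix.fromBlocks 0 0 0
    (ofBlocks (n + 3) (n + 1) fun i k =>
      if i = k + 1 then (2 * ((k : ℝ) + 1) / (b - a)) • matN else 0)

/-- The sqrt-Laplacian matrix operator `A^I`, `I = [a, b]`. -/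
def matA (a b : ℝ) (n : ℕ) : Matrix (BlockIdx (n + 3)) (BlockIdx (n + 1)) ℝ :=
  Matrix.fromBlocks 0 0 0
    (ofBlocks (n + 3) (n + 1) fun i k =>
      if i = k + 1 then (2 * ((k : ℝ) + 1) / (b - a)) • matM else 0)

/-- At most two nonzero entries per column, and the `2 × 2` block in block position `(i, k)`
vanishes unless `k ≤ i ≤ k + 2`. -/
def IsSparseBanded {p q : ℕ} (X : Matrix (BlockIdx p) (BlockIdx q) ℝ) : Prop :=
  (∀ j, {i | X i j ≠ 0}.ncard ≤ 2) ∧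
    ∀ (i : Fin p) (k : Fin q) (r c : Fin 2), X (Sum.inr (i, r)) (Sum.inr (k, c)) ≠ 0 →
      (k : ℕ) ≤ i ∧ (i : ℕ) ≤ k + 2

end SumSpace

end

/-!
For `z` in the closed upper half-plane let `F(z) = z - √(z² - 1)` (`jouk`) be the inverse Joukowski
map, with values in the unit disc. It is holomorphic in the open half-plane, bounded by
`min 1 (1 / |z|)`, Hölder continuous of exponent `1 / 2` up to the real line, and extends
holomorphically across every real point except `±1`. Its boundary values are `exp (-iθ)` at
`x = cos θ`, and `x - sgn(x) √(x² - 1)` off the cut, so `F ^ (k + 1)` has boundary values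
`T̃_{k+1} - i W_k` (`jouk_pow_ofReal_re`, `jouk_pow_ofReal_im`), while `F' = -F / √(z² - 1)` shows
that its derivative has boundary values `(k + 1) (Ũ_k + i V_{k+1})` (`deriv_jouk_pow_ofReal`). Thus
all four families are boundary values of one holomorphic function, and composition with the affine
map (`joukPow`) preserves these properties.

On boundary values of holomorphic functions of the upper half-plane the Hilbert transform is
multiplication by `-i`, and the half-Laplacian is `-i` times the complex derivative. Both follow
from Cauchy's theorem (`integral_ofReal_eq_zero`): subtracting a multiple of `i / (z + i)` removes
the pole and leaves a half-residue (`integral_Ioi_sub_div`), and the double pole reduces to the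
simple one through divided differences (`integral_Ioi_secondDiff_div`). Principal values are treated
as absolutely convergent integrals of symmetrised integrands (`hasPVIntegral_of_integrableOn`).

For the distributional identity, Fubini's theorem and translation invariance show that the
half-Laplacian is symmetric when tested on a bounded function with second differences `O(s²)`
(`integral_mul_halfLaplacian`). This applies to `F ^ (k + 1)` on the lines `Im z = ε`. As `ε → 0`,
dominated convergence applies because `F'` has only inverse square root singularities
(`hasDistribFracLaplacian_boundary`).
-/

namespace SumSpace

open MeasureTheory Filter Topology Complex Set

/-! ### The inverse Joukowski map on the closed upper half-plane -/

/-- The branch of `√(-iz)` with nonnegative real part. Its cut is the negative imaginary axis, so it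
is holomorphic near every nonzero point of the closed upper half-plane. -/
noncomputable def rotSqrt (z : ℂ) : ℂ := Complex.sqrt (-I * z)

lemma rotSqrt_sq (z : ℂ) : rotSqrt z ^ 2 = -I * z := by
  unfold rotSqrt Complex.sqrt
  exact cpow_nat_inv_pow (-I * z) (n := 2) two_ne_zero

lemma rotSqrt_re_nonneg (z : ℂ) : 0 ≤ (rotSqrt z).re := by
  unfold rotSqrt Complex.sqrt
  rw [cpow_inv_two_re]
  positivity

lemma abs_rotSqrt_im_le_re {z : ℂ} (hz : 0 ≤ z.im) : |(rotSqrt z).im| ≤ (rotSqrt z).re := by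
  have h := congrArg Complex.re (rotSqrt_sq z)
  simp only [pow_two, Complex.mul_re, Complex.neg_re, Complex.I_re, Complex.neg_im,
    Complex.I_im] at h
  apply abs_le_of_sq_le_sq _ (rotSqrt_re_nonneg z)
  nlinarith

lemma rotSqrt_re_inner_nonneg {z w : ℂ} (hz : 0 ≤ z.im) (hw : 0 ≤ w.im) :
    0 ≤ (rotSqrt z).re * (rotSqrt w).re + (rotSqrt z).im * (rotSqrt w).im := by
  have h1 := abs_rotSqrt_im_le_re hz
  have h2 := abs_rotSqrt_im_le_re hw
  have h3 : |(rotSqrt z).im * (rotSqrt w).im| ≤ (rotSqrt z).re * (rotSqrt w).re := by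
    rw [abs_mul]
    exact mul_le_mul h1 h2 (abs_nonneg _) (rotSqrt_re_nonneg z)
  linarith [neg_abs_le ((rotSqrt z).im * (rotSqrt w).im)]

/-- Both values of `rotSqrt` lie in the sector `|arg| ≤ π / 4`, hence make an acute angle. -/
lemma norm_rotSqrt_add_sq_ge {z w : ℂ} (hz : 0 ≤ z.im) (hw : 0 ≤ w.im) :
    ‖z‖ + ‖w‖ ≤ ‖rotSqrt z + rotSqrt w‖ ^ 2 := by
  have h1 : ‖rotSqrt z‖ ^ 2 = ‖z‖ := by rw [← norm_pow, rotSqrt_sq]; simp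
  have h2 : ‖rotSqrt w‖ ^ 2 = ‖w‖ := by rw [← norm_pow, rotSqrt_sq]; simp
  have h3 := rotSqrt_re_inner_nonneg hz hw
  rw [← h1, ← h2]
  simp only [← Complex.normSq_eq_norm_sq, Complex.normSq_apply, Complex.add_re, Complex.add_im]
  nlinarith

lemma norm_rotSqrt_sub_sq_le {z w : ℂ} (hz : 0 ≤ z.im) (hw : 0 ≤ w.im) :
    ‖rotSqrt z - rotSqrt w‖ ^ 2 ≤ ‖z - w‖ := by
  have h3 := rotSqrt_re_inner_nonneg hz hw
  have h4 : ‖rotSqrt z - rotSqrt w‖ ≤ ‖rotSqrt z + rotSqrt w‖ := by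
    rw [← sq_le_sq₀ (norm_nonneg _) (norm_nonneg _)]
    simp only [← Complex.normSq_eq_norm_sq, Complex.normSq_apply, Complex.add_re, Complex.add_im,
      Complex.sub_re, Complex.sub_im]
    nlinarith
  have h5 : ‖rotSqrt z - rotSqrt w‖ * ‖rotSqrt z + rotSqrt w‖ = ‖z - w‖ := by
    have h6 : (rotSqrt z - rotSqrt w) * (rotSqrt z + rotSqrt w) = -I * (z - w) := by
      linear_combination rotSqrt_sq z - rotSqrt_sq w
    rw [← norm_mul, h6]
    simp
  rw [← h5, pow_two]
  exact mul_le_mul_of_nonneg_left h4 (norm_nonneg _)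

lemma norm_rotSqrt_sub_le {z w : ℂ} (hz : 0 ≤ z.im) (hw : 0 ≤ w.im) :
    ‖rotSqrt z - rotSqrt w‖ ≤ √‖z - w‖ :=
  Real.le_sqrt_of_sq_le (norm_rotSqrt_sub_sq_le hz hw)

lemma rotSqrt_ne_zero {z : ℂ} (hz : z ≠ 0) : rotSqrt z ≠ 0 := by
  intro h
  have h1 := rotSqrt_sq z
  rw [h] at h1
  simp [hz] at h1

lemma neg_I_mul_mem_slitPlane {z : ℂ} (hz : 0 ≤ z.im) (h0 : z ≠ 0) : -I * z ∈ slitPlane := by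
  rw [mem_slitPlane_iff]
  rcases hz.lt_or_eq with h | h
  · left; simpa using h
  · right
    intro h1
    apply h0
    apply Complex.ext
    · simpa using h1
    · simpa using h.symm

/-- The derivative is found by differentiating `rotSqrt z ^ 2 = -iz`. -/
lemma hasDerivAt_rotSqrt {z : ℂ} (hz : 0 ≤ z.im) (h0 : z ≠ 0) :
    HasDerivAt rotSqrt (-I / (2 * rotSqrt z)) z := by
  have hd : DifferentiableAt ℂ rotSqrt z :=
    (differentiableAt_sqrt (neg_I_mul_mem_slitPlane hz h0)).comp z ((differentiableAt_id).const_mul (-I))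
  have h2 := hd.hasDerivAt.pow 2
  have h3 : HasDerivAt (fun z => -I * z) (-I) z := by
    simpa using (hasDerivAt_id z).const_mul (-I)
  have h4 : (fun z => -I * z) = rotSqrt ^ 2 := by
    funext z; simp [rotSqrt_sq]
  rw [h4] at h3
  have h5 := h2.unique h3
  have h6 := rotSqrt_ne_zero h0
  have h7 : deriv rotSqrt z = -I / (2 * rotSqrt z) := by
    field_simp
    simpa [mul_comm, mul_assoc, mul_left_comm] using h5
  rw [← h7]
  exact hd.hasDerivAt

lemma rotSqrt_ofReal_of_nonneg {x : ℝ} (hx : 0 ≤ x) :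
    rotSqrt x = (√(x / 2) : ℝ) * (1 - I) := by
  have h1 := abs_rotSqrt_im_le_re (z := (x : ℂ)) (by simp)
  have h2 := rotSqrt_sq (x : ℂ)
  have h3 := congrArg Complex.re h2
  have h4 := congrArg Complex.im h2
  simp only [pow_two, Complex.mul_re, Complex.mul_im, Complex.neg_re, Complex.I_re, Complex.neg_im,
    Complex.I_im, Complex.ofReal_re, Complex.ofReal_im] at h3 h4
  rw [abs_le] at h1
  have h5 : (rotSqrt x).im = -(rotSqrt x).re := by
    have : ((rotSqrt x).re - (rotSqrt x).im) * ((rotSqrt x).re + (rotSqrt x).im) = 0 := by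
      linarith
    rcases mul_eq_zero.1 this with h | h
    · have : (rotSqrt x).re = 0 := by nlinarith
      linarith
    · linarith
  have h6 : (rotSqrt x).re = √(x / 2) := by
    symm
    rw [Real.sqrt_eq_iff_mul_self_eq (by positivity) (by linarith)]
    rw [h5] at h4
    linarith
  apply Complex.ext
  · simp [h6]
  · simp [h5, h6]

lemma rotSqrt_ofReal_of_nonpos {x : ℝ} (hx : x ≤ 0) :
    rotSqrt x = (√(-x / 2) : ℝ) * (1 + I) := by
  have h1 := abs_rotSqrt_im_le_re (z := (x : ℂ)) (by simp)
  have h2 := rotSqrt_sq (x : ℂ)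
  have h3 := congrArg Complex.re h2
  have h4 := congrArg Complex.im h2
  simp only [pow_two, Complex.mul_re, Complex.mul_im, Complex.neg_re, Complex.I_re, Complex.neg_im,
    Complex.I_im, Complex.ofReal_re, Complex.ofReal_im] at h3 h4
  rw [abs_le] at h1
  have h5 : (rotSqrt x).im = (rotSqrt x).re := by
    have : ((rotSqrt x).re - (rotSqrt x).im) * ((rotSqrt x).re + (rotSqrt x).im) = 0 := by
      linarith
    rcases mul_eq_zero.1 this with h | h
    · linarith
    · have : (rotSqrt x).re = 0 := by nlinarith
      linarith
  have h6 : (rotSqrt x).re = √(-x / 2) := by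
    symm
    rw [Real.sqrt_eq_iff_mul_self_eq (by linarith) (by linarith)]
    rw [h5] at h4
    linarith
  apply Complex.ext
  · simp [h6]
  · simp [h5, h6]

/-- The branch of `√(z² - 1)` on the closed upper half-plane that behaves like `z` at infinity. -/
noncomputable def joukRoot (z : ℂ) : ℂ := I * (rotSqrt (z - 1) * rotSqrt (z + 1))

/-- The inverse Joukowski map `z - √(z² - 1)` from the upper half-plane into the unit disc. -/
noncomputable def jouk (z : ℂ) : ℂ := z - joukRoot z

lemma joukRoot_sq (z : ℂ) : joukRoot z ^ 2 = z ^ 2 - 1 := by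
  unfold joukRoot
  rw [mul_pow, mul_pow, rotSqrt_sq, rotSqrt_sq]
  linear_combination (z ^ 2 - 1) * (I ^ 2 - 1) * I_sq

/-- Both `jouk z` and `1 / jouk z` solve `w² = 2zw - 1`, the characteristic equation of the Chebyshev
three-term recurrence. -/
lemma jouk_sq (z : ℂ) : jouk z ^ 2 = 2 * z * jouk z - 1 := by
  unfold jouk
  linear_combination joukRoot_sq z

/-- Together with `jouk_mul_sq`, this reduces size and continuity of `jouk` to those of the two square
roots. -/
lemma jouk_eq_sq (z : ℂ) : jouk z = I / 2 * (rotSqrt (z - 1) - rotSqrt (z + 1)) ^ 2 := by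
  unfold jouk joukRoot
  linear_combination (-I / 2) * (rotSqrt_sq (z - 1) + rotSqrt_sq (z + 1)) + z * I_sq

lemma jouk_mul_sq (z : ℂ) : jouk z * (rotSqrt (z - 1) + rotSqrt (z + 1)) ^ 2 = -2 * I := by
  have h : (rotSqrt (z - 1) - rotSqrt (z + 1)) * (rotSqrt (z - 1) + rotSqrt (z + 1)) = 2 * I := by
    linear_combination rotSqrt_sq (z - 1) - rotSqrt_sq (z + 1)
  rw [jouk_eq_sq, mul_assoc, ← mul_pow, h]
  linear_combination (2 * I) * I_sq

lemma norm_rotSqrt_sub_le_sqrt_two {z : ℂ} (hz : 0 ≤ z.im) :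
    ‖rotSqrt (z - 1) - rotSqrt (z + 1)‖ ≤ √2 := by
  have := norm_rotSqrt_sub_le (z := z - 1) (w := z + 1) (by simpa using hz) (by simpa using hz)
  have h2 : z - 1 - (z + 1) = -2 := by ring
  rw [h2] at this
  simpa using this

lemma norm_jouk_le_one {z : ℂ} (hz : 0 ≤ z.im) : ‖jouk z‖ ≤ 1 := by
  have h := norm_rotSqrt_sub_le_sqrt_two hz
  have h2 : ‖rotSqrt (z - 1) - rotSqrt (z + 1)‖ ^ 2 ≤ 2 := by
    calc _ ≤ (√2) ^ 2 := by gcongr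
      _ = 2 := by simp
  rw [jouk_eq_sq, norm_mul, norm_pow]
  simp only [norm_div, norm_I, Complex.norm_ofNat]
  linarith

lemma norm_jouk_mul_norm_le {z : ℂ} (hz : 0 ≤ z.im) : ‖jouk z‖ * ‖z‖ ≤ 1 := by
  have h := congrArg norm (jouk_mul_sq z)
  simp only [norm_mul, norm_pow, norm_neg, Complex.norm_ofNat, norm_I, mul_one] at h
  have h1 := norm_rotSqrt_add_sq_ge (z := z - 1) (w := z + 1) (by simpa using hz) (by simpa using hz)
  have h2 : 2 * ‖z‖ ≤ ‖z - 1‖ + ‖z + 1‖ := by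
    have : (2 : ℂ) * z = (z - 1) + (z + 1) := by ring
    calc 2 * ‖z‖ = ‖(2 : ℂ) * z‖ := by simp
      _ ≤ _ := by rw [this]; exact norm_add_le _ _
  have h3 := mul_le_mul_of_nonneg_left (h2.trans h1) (norm_nonneg (jouk z))
  linarith

lemma norm_jouk_sub_le {z w : ℂ} (hz : 0 ≤ z.im) (hw : 0 ≤ w.im) :
    ‖jouk z - jouk w‖ ≤ 4 * √‖z - w‖ := by
  have e : jouk z - jouk w = I / 2 * ((rotSqrt (z - 1) - rotSqrt (w - 1))
      - (rotSqrt (z + 1) - rotSqrt (w + 1))) * ((rotSqrt (z - 1) - rotSqrt (z + 1))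
      + (rotSqrt (w - 1) - rotSqrt (w + 1))) := by
    rw [jouk_eq_sq, jouk_eq_sq]; ring
  have h1 := norm_rotSqrt_sub_le (z := z - 1) (w := w - 1) (by simpa using hz) (by simpa using hw)
  have h2 := norm_rotSqrt_sub_le (z := z + 1) (w := w + 1) (by simpa using hz) (by simpa using hw)
  rw [sub_sub_sub_cancel_right] at h1
  rw [add_sub_add_right_eq_sub] at h2
  have h3 := norm_rotSqrt_sub_le_sqrt_two hz
  have h4 := norm_rotSqrt_sub_le_sqrt_two hw
  have h5 : √2 ≤ 2 := by rw [Real.sqrt_le_left (by norm_num)]; norm_num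
  rw [e, norm_mul, norm_mul]
  simp only [norm_div, norm_I, Complex.norm_ofNat]
  have h6 := (norm_sub_le (rotSqrt (z - 1) - rotSqrt (w - 1))
      (rotSqrt (z + 1) - rotSqrt (w + 1))).trans (add_le_add h1 h2)
  have h7 := (norm_add_le (rotSqrt (z - 1) - rotSqrt (z + 1))
    (rotSqrt (w - 1) - rotSqrt (w + 1))).trans (add_le_add h3 h4)
  calc _ ≤ 1 / 2 * (√‖z - w‖ + √‖z - w‖) * (2 + 2) := by gcongr; linarith
    _ = _ := by ring

lemma continuousOn_jouk : ContinuousOn jouk {z | 0 ≤ z.im} := by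
  intro w hw
  rw [ContinuousWithinAt, tendsto_iff_norm_sub_tendsto_zero]
  refine squeeze_zero' (.of_forall fun _ => norm_nonneg _)
    (eventually_mem_nhdsWithin.mono fun z hz => norm_jouk_sub_le hz hw) ?_
  have : ContinuousAt (fun z : ℂ => 4 * √‖z - w‖) w := by fun_prop
  simpa [ContinuousAt] using this.tendsto.mono_left nhdsWithin_le_nhds

lemma norm_joukRoot_sq (z : ℂ) : ‖joukRoot z‖ ^ 2 = ‖z - 1‖ * ‖z + 1‖ := by
  rw [← norm_pow, joukRoot_sq, ← norm_mul]
  ring_nf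

lemma joukRoot_ne_zero {z : ℂ} (h1 : z ≠ 1) (h2 : z ≠ -1) : joukRoot z ≠ 0 := by
  intro h
  have := norm_joukRoot_sq z
  rw [h] at this
  simp only [norm_zero, ne_eq, OfNat.ofNat_ne_zero, not_false_eq_true, zero_pow, zero_eq_mul,
    norm_eq_zero] at this
  rcases this with h | h
  · exact h1 (sub_eq_zero.1 h)
  · exact h2 (eq_neg_of_add_eq_zero_left h)

lemma hasDerivAt_jouk {z : ℂ} (hz : 0 ≤ z.im) (h1 : z ≠ 1) (h2 : z ≠ -1) :
    HasDerivAt jouk (-jouk z / joukRoot z) z := by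
  have h1' : z - 1 ≠ 0 := sub_ne_zero.2 h1
  have h2' : z + 1 ≠ 0 := fun h => h2 (eq_neg_of_add_eq_zero_left h)
  have d1 : HasDerivAt (fun z => rotSqrt (z - 1)) _ z :=
    (hasDerivAt_rotSqrt (z := z - 1) (by simpa using hz) h1').comp_sub_const z 1
  have d2 : HasDerivAt (fun z => rotSqrt (z + 1)) _ z :=
    (hasDerivAt_rotSqrt (z := z + 1) (by simpa using hz) h2').comp_add_const z 1
  have d3 := (hasDerivAt_id z).sub ((d1.mul d2).const_mul I)
  refine d3.congr_deriv ?_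
  have n1 := rotSqrt_ne_zero h1'
  have n2 := rotSqrt_ne_zero h2'
  have n3 := joukRoot_ne_zero h1 h2
  unfold jouk
  have s1 := rotSqrt_sq (z - 1)
  have s2 := rotSqrt_sq (z + 1)
  unfold joukRoot at n3 ⊢
  generalize rotSqrt (z - 1) = p at *
  generalize rotSqrt (z + 1) = q at *
  field_simp
  linear_combination (-I) * (s1 + s2) + (I * (p ^ 2 + q ^ 2) + 2 * z) * I_sq

/-! ### Boundary values: the sum space and its dual -/

lemma joukRoot_ofReal_of_abs_le {x : ℝ} (hx : |x| ≤ 1) : joukRoot x = (√(1 - x ^ 2) : ℝ) * I := by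
  obtain ⟨h1, h2⟩ := abs_le.1 hx
  have e1 : (x : ℂ) - 1 = ((x - 1 : ℝ) : ℂ) := by push_cast; ring
  have e2 : (x : ℂ) + 1 = ((x + 1 : ℝ) : ℂ) := by push_cast; ring
  rw [joukRoot, e1, e2, rotSqrt_ofReal_of_nonpos (by linarith),
    rotSqrt_ofReal_of_nonneg (by linarith)]
  have h : √(1 - x ^ 2) = 2 * (√(-(x - 1) / 2) * √((x + 1) / 2)) := by
    rw [← Real.sqrt_mul (by linarith), show 1 - x ^ 2 = 2 ^ 2 * (-(x - 1) / 2 * ((x + 1) / 2)) by ring,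
      Real.sqrt_mul (by norm_num), Real.sqrt_sq (by norm_num)]
  rw [h]
  push_cast
  linear_combination (-I * √(-(x - 1) / 2) * √((x + 1) / 2)) * I_sq

lemma joukRoot_ofReal_of_one_lt {x : ℝ} (hx : 1 < x) : joukRoot x = (√(x ^ 2 - 1) : ℝ) := by
  have e1 : (x : ℂ) - 1 = ((x - 1 : ℝ) : ℂ) := by push_cast; ring
  have e2 : (x : ℂ) + 1 = ((x + 1 : ℝ) : ℂ) := by push_cast; ring
  rw [joukRoot, e1, e2, rotSqrt_ofReal_of_nonneg (by linarith),
    rotSqrt_ofReal_of_nonneg (by linarith)]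
  have h : √(x ^ 2 - 1) = 2 * (√((x - 1) / 2) * √((x + 1) / 2)) := by
    rw [← Real.sqrt_mul (by linarith), show x ^ 2 - 1 = 2 ^ 2 * ((x - 1) / 2 * ((x + 1) / 2)) by ring,
      Real.sqrt_mul (by norm_num), Real.sqrt_sq (by norm_num)]
  rw [h]
  push_cast
  linear_combination ((I - 2) * √((x - 1) / 2) * √((x + 1) / 2)) * I_sq

lemma joukRoot_ofReal_of_lt_neg_one {x : ℝ} (hx : x < -1) :
    joukRoot x = -(√(x ^ 2 - 1) : ℝ) := by
  have e1 : (x : ℂ) - 1 = ((x - 1 : ℝ) : ℂ) := by push_cast; ring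
  have e2 : (x : ℂ) + 1 = ((x + 1 : ℝ) : ℂ) := by push_cast; ring
  rw [joukRoot, e1, e2, rotSqrt_ofReal_of_nonpos (by linarith),
    rotSqrt_ofReal_of_nonpos (by linarith)]
  have h : √(x ^ 2 - 1) = 2 * (√(-(x - 1) / 2) * √(-(x + 1) / 2)) := by
    rw [← Real.sqrt_mul (by linarith),
      show x ^ 2 - 1 = 2 ^ 2 * (-(x - 1) / 2 * (-(x + 1) / 2)) by ring,
      Real.sqrt_mul (by norm_num), Real.sqrt_sq (by norm_num)]
  rw [h]
  push_cast
  linear_combination ((I + 2) * √(-(x - 1) / 2) * √(-(x + 1) / 2)) * I_sq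

lemma joukRoot_ofReal_of_one_lt_abs {x : ℝ} (hx : 1 < |x|) :
    joukRoot x = (Real.sign x * √(x ^ 2 - 1) : ℝ) := by
  rcases lt_abs.1 hx with h | h
  · rw [joukRoot_ofReal_of_one_lt h, Real.sign_of_pos (by linarith), one_mul]
  · rw [joukRoot_ofReal_of_lt_neg_one (by linarith), Real.sign_of_neg (by linarith)]
    push_cast; ring

lemma jouk_ofReal_of_one_lt_abs {x : ℝ} (hx : 1 < |x|) :
    jouk x = (x - Real.sign x * √(x ^ 2 - 1) : ℝ) := by
  rw [jouk, joukRoot_ofReal_of_one_lt_abs hx]; push_cast; ring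

/-- On the cut, `jouk (cos θ) = exp (-iθ)`, so its powers have the Chebyshev polynomials as real
and imaginary parts. -/
lemma jouk_pow_ofReal_of_abs_le {x : ℝ} (hx : |x| ≤ 1) (m : ℕ) :
    jouk x ^ (m + 1) = ((Polynomial.Chebyshev.T ℝ (m + 1 : ℕ)).eval x : ℝ) -
      (√(1 - x ^ 2) * (Polynomial.Chebyshev.U ℝ m).eval x : ℝ) * I := by
  have h0 : jouk x = x - (√(1 - x ^ 2) : ℝ) * I := by rw [jouk, joukRoot_ofReal_of_abs_le hx]
  induction m using Nat.twoStepInduction with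
  | zero => simp [h0]
  | one =>
    rw [show 1 + 1 = 2 from rfl, jouk_sq, h0]
    simp only [Nat.cast_ofNat, Polynomial.Chebyshev.T_two, Nat.cast_one,
      Polynomial.Chebyshev.U_one]
    simp only [Polynomial.eval_sub, Polynomial.eval_mul, Polynomial.eval_ofNat,
      Polynomial.eval_pow, Polynomial.eval_X, Polynomial.eval_one]
    push_cast
    ring
  | more k ih1 ih2 =>
    have e : jouk x ^ (k + 2 + 1) = 2 * x * jouk x ^ (k + 1 + 1) - jouk x ^ (k + 1) := by
      linear_combination jouk x ^ (k + 1) * jouk_sq x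
    rw [e, ih1, ih2]
    have t := Polynomial.Chebyshev.T_add_two ℝ (k + 1 : ℕ)
    have t' : ((k + 2 + 1 : ℕ) : ℤ) = ((k + 1 : ℕ) : ℤ) + 2 := by push_cast; ring
    have t'' : ((k + 1 + 1 : ℕ) : ℤ) = ((k + 1 : ℕ) : ℤ) + 1 := by push_cast; ring
    have u : Polynomial.Chebyshev.U ℝ (((k + 1 : ℕ) : ℤ) + 1) =
        2 * Polynomial.X * Polynomial.Chebyshev.U ℝ (k + 1 : ℕ) - Polynomial.Chebyshev.U ℝ k := by
      rw [show ((k + 1 : ℕ) : ℤ) = (k : ℤ) + 1 by push_cast; ring, add_assoc]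
      exact Polynomial.Chebyshev.U_add_two ℝ k
    rw [t', t, t'', u]
    simp only [Polynomial.eval_sub, Polynomial.eval_mul, Polynomial.eval_ofNat,
      Polynomial.eval_X]
    push_cast
    ring

lemma jouk_pow_ofReal_re (m : ℕ) (x : ℝ) : (jouk x ^ m).re = extT m x := by
  unfold extT
  split_ifs with h
  · rcases m with _ | m
    · simp
    · rw [jouk_pow_ofReal_of_abs_le h]
      simp only [sub_re, ofReal_re, mul_re, I_re, ofReal_im, mul_zero, zero_mul, sub_zero]
  · rw [jouk_ofReal_of_one_lt_abs (not_le.1 h), ← Complex.ofReal_pow, Complex.ofReal_re]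

lemma jouk_pow_ofReal_im (m : ℕ) (x : ℝ) : (jouk x ^ (m + 1)).im = -wtW m x := by
  unfold wtW
  rcases le_or_gt |x| 1 with h | h
  · rw [jouk_pow_ofReal_of_abs_le h]
    simp only [sub_im, ofReal_im, mul_im, ofReal_re, I_im, mul_one, I_re, mul_zero, add_zero,
      zero_sub, neg_inj]
    split_ifs with h'
    · rfl
    · have : |x| = 1 := le_antisymm h (not_lt.1 h')
      have : x ^ 2 = 1 := by rw [← sq_abs, this]; norm_num
      simp [this]
  · rw [jouk_ofReal_of_one_lt_abs h, ← Complex.ofReal_pow, Complex.ofReal_im, if_neg (not_lt.2 h.le),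
      neg_zero]

lemma extU_of_abs_le {x : ℝ} (hx : |x| ≤ 1) (m : ℕ) :
    extU (m + 2) x = (Polynomial.Chebyshev.U ℝ m).eval x := by
  induction m using Nat.twoStepInduction with
  | zero => simp [extU, extT, hx]
  | one => simp [extU, extT, hx]
  | more k ih1 ih2 =>
    have e : extU (k + 2 + 2) x = 2 * extT (k + 2) x + extU (k + 2) x := rfl
    have t := congrArg (Polynomial.eval x) (Polynomial.Chebyshev.T_eq_X_mul_U_sub_U ℝ (k : ℕ))
    have u := congrArg (Polynomial.eval x) (Polynomial.Chebyshev.U_add_two ℝ (k : ℕ))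
    rw [e, ih1, extT, if_pos hx]
    push_cast
    simp only [Polynomial.eval_sub, Polynomial.eval_mul, Polynomial.eval_ofNat,
      Polynomial.eval_X] at t u
    rw [t, u]
    ring

/-- Off the cut, `Ũ_{m-1} = -sgn(x) ρ ^ m / √(x² - 1)` with `ρ = x - sgn(x) √(x² - 1)`. The leading
function `Ũ_{-2}` does not follow this pattern. -/
lemma extU_of_one_lt_abs {x : ℝ} (hx : 1 < |x|) (m : ℕ) :
    extU (m + 1) x = -(Real.sign x * (x - Real.sign x * √(x ^ 2 - 1)) ^ m / √(x ^ 2 - 1)) := by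
  have h0 : 0 < x ^ 2 - 1 := by nlinarith [sq_abs x, abs_nonneg x]
  have h1 : √(x ^ 2 - 1) ≠ 0 := (Real.sqrt_pos.2 h0).ne'
  have h2 : √(x ^ 2 - 1) ^ 2 = x ^ 2 - 1 := Real.sq_sqrt h0.le
  have h3 : Real.sign x ^ 2 = 1 := by
    rcases lt_abs.1 hx with h | h
    · rw [Real.sign_of_pos (by linarith)]; norm_num
    · rw [Real.sign_of_neg (by linarith)]; norm_num
  have h4 : |x| = Real.sign x * x := by
    rcases lt_abs.1 hx with h | h
    · rw [Real.sign_of_pos (by linarith), abs_of_pos (by linarith)]; ring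
    · rw [Real.sign_of_neg (by linarith), abs_of_neg (by linarith)]; ring
  induction m using Nat.twoStepInduction with
  | zero => simp [extU, hx]
  | one =>
    have e : extU (1 + 1) x =
      extT 0 x + if |x| ≤ 1 then 0 else -(|x| / √(x ^ 2 - 1)) := rfl
    rw [e, extT, if_neg (not_le.2 hx), if_neg (not_le.2 hx), h4]
    field_simp
    linear_combination √(x ^ 2 - 1) * (-h3)
  | more k ih1 ih2 =>
    have e : extU (k + 2 + 1) x = 2 * extT (k + 1) x + extU (k + 1) x := rfl
    rw [e, ih1, extT, if_neg (not_le.2 hx)]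
    generalize Real.sign x = σ at *
    generalize √(x ^ 2 - 1) = r at *
    field_simp
    rw [pow_succ (x - σ * r) k, pow_add (x - σ * r) k 2]
    linear_combination (x - σ * r) ^ k * ((-2 * r * x + σ * r ^ 2) * h3 - σ * h2)

/-- The derivative of `jouk ^ (m + 1)` on the real line, read off from `jouk' = -jouk / √(z² - 1)`,
is a pair of functions of the dual sum space. -/
lemma deriv_jouk_pow_ofReal {x : ℝ} (h1 : x ≠ 1) (h2 : x ≠ -1) (m : ℕ) :
    jouk x ^ m * (-jouk x / joukRoot x) = ⟨extU (m + 2) x, wtV (m + 1) x⟩ := by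
  have e : jouk x ^ m * (-jouk x / joukRoot x) = -(jouk x ^ (m + 1) / joukRoot x) := by ring
  rw [e]
  rcases lt_trichotomy |x| 1 with h | h | h
  · have h0 : 0 < 1 - x ^ 2 := by nlinarith [sq_abs x, abs_nonneg x]
    have h3 : √(1 - x ^ 2) ≠ 0 := (Real.sqrt_pos.2 h0).ne'
    have h4 : ((√(1 - x ^ 2) : ℝ) : ℂ) ≠ 0 := by exact_mod_cast h3
    rw [extU_of_abs_le h.le, wtV, if_pos h, jouk_pow_ofReal_of_abs_le h.le,
      joukRoot_ofReal_of_abs_le h.le, Complex.mk_eq_add_mul_I]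
    push_cast
    field_simp
    linear_combination (-((Polynomial.Chebyshev.T ℂ (m + 1)).eval (x : ℂ))) * I_sq
  · rcases eq_or_eq_neg_of_abs_eq h with h | h <;> contradiction
  · have h0 : 0 < x ^ 2 - 1 := by nlinarith [sq_abs x, abs_nonneg x]
    have h3 : √(x ^ 2 - 1) ≠ 0 := (Real.sqrt_pos.2 h0).ne'
    rw [extU_of_one_lt_abs h, wtV, if_neg (not_lt.2 h.le), jouk_ofReal_of_one_lt_abs h,
      joukRoot_ofReal_of_one_lt_abs h, ← ofReal_pow, ← ofReal_div, ← ofReal_neg]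
    apply Complex.ext
    · rw [ofReal_re]
      rcases lt_abs.1 h with h | h
      · rw [Real.sign_of_pos (by linarith)]; simp
      · rw [Real.sign_of_neg (by linarith)]; simp [div_neg, neg_div]
    · rw [ofReal_im]

/-! ### Cauchy's theorem on the upper half-plane and half-residues -/

lemma intervalIntegrable_inv_sqrt_abs (a b : ℝ) :
    IntervalIntegrable (fun t : ℝ => (√|t|)⁻¹) volume a b := by
  have h : ∀ t, IntervalIntegrable (fun t : ℝ => (√|t|)⁻¹) volume 0 t := by
    intro t
    apply intervalIntegrable_of_even (fun x => by rw [abs_neg])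
    intro x hx
    refine (intervalIntegral.intervalIntegrable_rpow' (r := -(1 / 2)) (by norm_num)).congr ?_
    intro t ht
    rw [uIoc_of_le hx.le] at ht
    simp only
    rw [Real.rpow_neg ht.1.le, ← Real.sqrt_eq_rpow, abs_of_pos ht.1]
  exact (h a).symm.trans (h b)

/-- An integrable majorant on the real line of functions which are `O(|t|^(-1/2))` at the origin and
`O(|t|⁻²)` at infinity. -/
noncomputable def sqrtKernel (t : ℝ) : ℝ :=
  (Icc (-1) 1).indicator (fun t => (√|t|)⁻¹) t + 2 * (1 + t ^ 2)⁻¹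

lemma integrable_sqrtKernel : Integrable sqrtKernel := by
  refine Integrable.add ?_ (integrable_inv_one_add_sq.const_mul 2)
  rw [integrable_indicator_iff measurableSet_Icc,
    ← intervalIntegrable_iff_integrableOn_Icc_of_le (by norm_num)]
  exact intervalIntegrable_inv_sqrt_abs _ _

/-- The bound depends on `z.re` only, so it is uniform on vertical half-lines. -/
lemma norm_le_sqrtKernel {f : ℂ → ℂ} {M : ℝ} {z : ℂ} (h0 : z.re ≠ 0)
    (h1 : ‖f z‖ * √‖z‖ ≤ M) (h2 : ‖f z‖ * ‖z‖ ^ 2 ≤ M) : ‖f z‖ ≤ M * sqrtKernel z.re := by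
  have hM : 0 ≤ M := le_trans (by positivity) h1
  have hr := Complex.abs_re_le_norm z
  have hp : 0 < |z.re| := abs_pos.2 h0
  unfold sqrtKernel
  by_cases h : z.re ∈ Icc (-1 : ℝ) 1
  · rw [indicator_of_mem h]
    have h3 : ‖f z‖ * √|z.re| ≤ M := le_trans (by gcongr) h1
    have h4 : ‖f z‖ ≤ M * (√|z.re|)⁻¹ := by
      rwa [← div_eq_mul_inv, le_div_iff₀ (Real.sqrt_pos.2 hp)]
    refine h4.trans (mul_le_mul_of_nonneg_left ?_ hM)
    have : 0 ≤ 2 * (1 + z.re ^ 2)⁻¹ := by positivity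
    linarith
  · rw [indicator_of_notMem h, zero_add]
    have h5 : 1 ≤ z.re ^ 2 := by
      by_contra hlt
      have := (abs_le_one_iff_mul_self_le_one (a := z.re)).2 (by nlinarith)
      exact h (abs_le.1 this)
    have h3 : ‖f z‖ * |z.re| ^ 2 ≤ M := le_trans (by gcongr) h2
    rw [sq_abs] at h3
    have : 0 < 1 + z.re ^ 2 := by positivity
    rw [← mul_assoc, ← div_eq_mul_inv, le_div_iff₀ this]
    nlinarith [norm_nonneg (f z)]

/-- **Cauchy's theorem** on the boundary of the upper half-plane, for a function with an integrable
singularity at the origin: integrate over the boundary of `[-R, R] × [ε, R]`, let `R → ∞`, and then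
let `ε → 0`. -/
lemma integral_ofReal_eq_zero {f : ℂ → ℂ} {M : ℝ} (hd : DifferentiableOn ℂ f {z | 0 < z.im})
    (hc : ∀ t : ℝ, t ≠ 0 → ContinuousWithinAt f {z | 0 ≤ z.im} t)
    (h1 : ∀ z : ℂ, 0 ≤ z.im → ‖f z‖ * √‖z‖ ≤ M) (h2 : ∀ z : ℂ, 0 ≤ z.im → ‖f z‖ * ‖z‖ ^ 2 ≤ M) :
    Integrable (fun t : ℝ => f t) ∧ ∫ t : ℝ, f t = 0 := by
  have hM : 0 ≤ M := le_trans (by positivity) (h1 0 (by simp))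
  have hbound : ∀ ε : ℝ, 0 ≤ ε → ∀ t : ℝ, t ≠ 0 → ‖f (t + ε * I)‖ ≤ M * sqrtKernel t := by
    intro ε hε t ht
    have him : 0 ≤ (t + ε * I : ℂ).im := by simpa using hε
    have hre : (t + ε * I : ℂ).re = t := by simp
    have := norm_le_sqrtKernel (by rwa [hre]) (h1 _ him) (h2 _ him)
    rwa [hre] at this
  have hne : ∀ᵐ t : ℝ, t ≠ 0 := by simp [ae_iff, measure_singleton]
  have hcont : ∀ ε : ℝ, 0 < ε → Continuous fun t : ℝ => f (t + ε * I) := by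
    intro ε hε
    refine ContinuousOn.comp_continuous hd.continuousOn (by fun_prop) fun t => ?_
    simpa using hε
  have hint : ∀ ε : ℝ, 0 < ε → Integrable fun t : ℝ => f (t + ε * I) := by
    intro ε hε
    refine (integrable_sqrtKernel.const_mul M).mono' (hcont ε hε).aestronglyMeasurable ?_
    filter_upwards [hne] with t ht using hbound ε hε.le t ht
  have hfar : ∀ (R : ℝ), 0 < R → ∀ z : ℂ, 0 ≤ z.im → R ≤ ‖z‖ → ‖f z‖ ≤ M / R ^ 2 := by
    intro R hR z hz hRz
    rw [le_div_iff₀ (by positivity)]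
    exact le_trans (by gcongr) (h2 z hz)
  have hzero : ∀ ε : ℝ, 0 < ε → ∫ t : ℝ, f (t + ε * I) = 0 := by
    intro ε hε
    have hl := intervalIntegral_tendsto_integral (hint ε hε) tendsto_neg_atTop_atBot tendsto_id
    refine tendsto_nhds_unique hl ?_
    refine squeeze_zero_norm' (a := fun R : ℝ => 4 * M * R⁻¹) ?_ ?_
    · filter_upwards [eventually_gt_atTop ε] with R hR
      have hR0 : 0 < R := hε.trans hR
      have key := Complex.integral_boundary_rect_eq_zero_of_differentiableOn f
        (-(R : ℂ) + ε * I) (R + R * I) (hd.mono ?_)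
      · simp only [add_re, neg_re, ofReal_re, mul_re, I_re, mul_zero, ofReal_im, I_im, mul_one,
          sub_self, add_zero, add_im, neg_im, neg_zero, mul_im, zero_add, smul_eq_mul] at key
        have b1 : ‖∫ x in (-R)..R, f (x + R * I)‖ ≤ M / R ^ 2 * |R - -R| := by
          refine intervalIntegral.norm_integral_le_of_norm_le_const fun t _ => ?_
          refine hfar R hR0 _ (by simpa using hR0.le) ?_
          refine le_trans ?_ (Complex.abs_im_le_norm _)
          simp [le_abs_self]
        have b2 : ‖∫ y in ε..R, f (R + y * I)‖ ≤ M / R ^ 2 * |R - ε| := by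
          refine intervalIntegral.norm_integral_le_of_norm_le_const fun t ht => ?_
          rw [uIoc_of_le hR.le] at ht
          refine hfar R hR0 _ (by simpa using (hε.trans ht.1).le) ?_
          refine le_trans ?_ (Complex.abs_re_le_norm _)
          simp [le_abs_self]
        have b3 : ‖∫ y in ε..R, f ((-R : ℝ) + y * I)‖ ≤ M / R ^ 2 * |R - ε| := by
          refine intervalIntegral.norm_integral_le_of_norm_le_const fun t ht => ?_
          rw [uIoc_of_le hR.le] at ht
          refine hfar R hR0 _ (by simpa using (hε.trans ht.1).le) ?_
          refine le_trans ?_ (Complex.abs_re_le_norm _)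
          simp [le_abs_self]
        have e : (∫ x in (-R)..R, f (x + ε * I)) = (∫ x in (-R)..R, f (x + R * I))
            - I * (∫ y in ε..R, f (R + y * I)) + I * (∫ y in ε..R, f ((-R : ℝ) + y * I)) := by
          linear_combination key
        rw [id, e]
        refine (norm_add_le _ _).trans ((add_le_add (norm_sub_le _ _) le_rfl).trans ?_)
        simp only [norm_mul, norm_I, one_mul]
        rw [abs_of_pos (by linarith)] at b1 b2 b3
        have e2 : 4 * M * R⁻¹ = M / R ^ 2 * (R - -R) + M / R ^ 2 * R + M / R ^ 2 * R := by
          field_simp; ring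
        have b4 : M / R ^ 2 * (R - ε) ≤ M / R ^ 2 * R := by gcongr; linarith
        rw [e2]
        linarith
      · intro z hz
        have := hz.2
        simp only [add_im, neg_im, ofReal_im, neg_zero, mul_im, ofReal_re, I_im, mul_one, I_re,
          mul_zero, add_zero, zero_add, mem_preimage] at this
        rw [uIcc_of_le hR.le] at this
        exact hε.trans_le this.1
    · simpa using tendsto_inv_atTop_zero.const_mul (4 * M)
  -- the approach to the boundary along the heights `1 / (n + 1)`
  have hpos : ∀ n : ℕ, (0 : ℝ) < 1 / ((n : ℝ) + 1) := fun n => by positivity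
  have hlim : ∀ᵐ t : ℝ, Tendsto (fun n : ℕ => f (t + (1 / ((n : ℝ) + 1) : ℝ) * I)) atTop
      (𝓝 (f t)) := by
    filter_upwards [hne] with t ht
    refine (hc t ht).tendsto.comp (tendsto_nhdsWithin_iff.2 ⟨?_, ?_⟩)
    · have h3 : Continuous fun ε : ℝ => (t + ε * I : ℂ) := by fun_prop
      have h4 := (h3.tendsto 0).comp tendsto_one_div_add_atTop_nhds_zero_nat
      rw [ofReal_zero, zero_mul, add_zero] at h4
      exact h4
    · refine .of_forall fun n => ?_
      simpa only [mem_ofPred_eq, add_im, ofReal_im, mul_im, ofReal_re, I_im, I_re, mul_one, mul_zero,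
        add_zero, zero_add] using (hpos n).le
  have hmeas : AEStronglyMeasurable (fun t : ℝ => f t) :=
    aestronglyMeasurable_of_tendsto_ae atTop
      (fun n : ℕ => (hcont _ (hpos n)).aestronglyMeasurable) hlim
  refine ⟨(integrable_sqrtKernel.const_mul M).mono' hmeas ?_, ?_⟩
  · filter_upwards [hne] with t ht
    simpa using hbound 0 le_rfl t ht
  · have h5 := tendsto_integral_of_dominated_convergence (fun t => M * sqrtKernel t)
      (fun n : ℕ => (hcont _ (hpos n)).aestronglyMeasurable) (integrable_sqrtKernel.const_mul M)
      (fun n => by filter_upwards [hne] with t ht using hbound _ (hpos n).le t ht) hlim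
    simp only [hzero _ (hpos _)] at h5
    exact tendsto_nhds_unique h5 tendsto_const_nhds

lemma integral_Ioi_add_comp_neg {E : Type*} [NormedAddCommGroup E] [NormedSpace ℝ E] {g : ℝ → E}
    (hg : Integrable g) :
    IntegrableOn (fun s => g s + g (-s)) (Ioi 0) ∧
      ∫ s in Ioi (0 : ℝ), (g s + g (-s)) = ∫ s, g s := by
  have h1 : IntegrableOn (fun s => g (-s)) (Ioi 0) := hg.comp_neg.integrableOn
  refine ⟨hg.integrableOn.add h1, ?_⟩
  rw [integral_add hg.integrableOn h1, integral_comp_neg_Ioi, neg_zero, add_comm,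
    intervalIntegral.integral_Iic_add_Ioi hg.integrableOn hg.integrableOn]

lemma norm_sq_add_one_le_norm_add_I_sq {z : ℂ} (hz : 0 ≤ z.im) :
    ‖z‖ ^ 2 + 1 ≤ ‖z + I‖ ^ 2 := by
  simp only [← Complex.normSq_eq_norm_sq, Complex.normSq_apply, add_re, add_im, I_re, I_im]
  nlinarith

/-- Half-residue formula: for `Ψ` holomorphic in the upper half-plane, decaying like `1 / z` and
Hölder continuous at the boundary point `0`, the symmetrised principal value of `∫ Ψ(t) / t dt` is
`πi Ψ(0)`. The function `i / (z + i)` is holomorphic in the upper half-plane and takes the value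
`1` at `0`, so subtracting `Ψ(0)` times it removes the pole. -/
lemma integral_Ioi_sub_div {Ψ : ℂ → ℂ} {C : ℝ} (hd : DifferentiableOn ℂ Ψ {z | 0 < z.im})
    (hc : ContinuousOn Ψ {z | 0 ≤ z.im}) (hb : ∀ z : ℂ, 0 ≤ z.im → ‖Ψ z‖ * ‖z‖ ≤ C)
    (hh : ∀ z : ℂ, 0 ≤ z.im → ‖Ψ z - Ψ 0‖ ≤ C * √‖z‖) :
    IntegrableOn (fun s : ℝ => (Ψ s - Ψ (-s)) / s) (Ioi 0) ∧
      ∫ s in Ioi (0 : ℝ), (Ψ s - Ψ (-s)) / s = Real.pi * I * Ψ 0 := by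
  have hC : 0 ≤ C := le_trans (by positivity) (hb 0 (by simp))
  set G : ℂ → ℂ := fun z => (Ψ z - Ψ 0 * (I / (z + I))) / z with hG
  have hzI : ∀ z : ℂ, 0 ≤ z.im → z + I ≠ 0 := by
    intro z hz h
    have := norm_sq_add_one_le_norm_add_I_sq hz
    rw [h] at this
    simp only [norm_zero, ne_eq, OfNat.ofNat_ne_zero, not_false_eq_true, zero_pow] at this
    nlinarith [sq_nonneg ‖z‖]
  have hz0 : ∀ z : ℂ, 0 < z.im → z ≠ 0 := by
    rintro z hz rfl
    simp at hz
  have hGd : DifferentiableOn ℂ G {z | 0 < z.im} := by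
    refine (hd.sub ((DifferentiableOn.div (differentiableOn_const I)
      (by fun_prop) fun z hz => hzI z (le_of_lt hz)).const_mul (Ψ 0))).div
      differentiableOn_id fun z hz => hz0 z hz
  have hGc : ∀ t : ℝ, t ≠ 0 → ContinuousWithinAt G {z | 0 ≤ z.im} t := by
    intro t ht
    have h2 : ContinuousAt (fun z : ℂ => I / (z + I)) t :=
      continuousAt_const.div (continuousAt_id.add continuousAt_const) (hzI t (by simp))
    exact ((hc t (by simp)).sub (continuousWithinAt_const.mul h2.continuousWithinAt)).div continuousWithinAt_id
      (by simpa using ht)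
  have hG1 : ∀ z : ℂ, 0 ≤ z.im → ‖G z‖ * √‖z‖ ≤ C + ‖Ψ 0‖ := by
    intro z hz
    rcases eq_or_ne z 0 with rfl | h0
    · simp; positivity
    have hr : 0 < ‖z‖ := norm_pos_iff.2 h0
    have hI := hzI z hz
    have e : Ψ z - Ψ 0 * (I / (z + I)) = (Ψ z - Ψ 0) + Ψ 0 * (z / (z + I)) := by
      field_simp; ring
    have b : ‖z / (z + I)‖ ≤ √‖z‖ := by
      rw [norm_div, div_le_iff₀ (norm_pos_iff.2 hI)]
      rw [← sq_le_sq₀ (by positivity) (by positivity), mul_pow, Real.sq_sqrt hr.le]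
      have := mul_le_mul_of_nonneg_left (norm_sq_add_one_le_norm_add_I_sq hz) hr.le
      refine le_trans ?_ this
      nlinarith [sq_nonneg (‖z‖ - 1)]
    have b2 : ‖Ψ z - Ψ 0 * (I / (z + I))‖ ≤ (C + ‖Ψ 0‖) * √‖z‖ := by
      rw [e]
      refine (norm_add_le _ _).trans ?_
      rw [norm_mul, add_mul]
      gcongr
      exact hh z hz
    rw [hG, norm_div, div_mul_eq_mul_div, div_le_iff₀ hr]
    calc _ ≤ (C + ‖Ψ 0‖) * √‖z‖ * √‖z‖ := by gcongr
      _ = _ := by rw [mul_assoc, Real.mul_self_sqrt hr.le]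
  have hG2 : ∀ z : ℂ, 0 ≤ z.im → ‖G z‖ * ‖z‖ ^ 2 ≤ C + ‖Ψ 0‖ := by
    intro z hz
    rcases eq_or_ne z 0 with rfl | h0
    · simp; positivity
    have hr : 0 < ‖z‖ := norm_pos_iff.2 h0
    have hI := norm_pos_iff.2 (hzI z hz)
    have e : ‖G z‖ * ‖z‖ ^ 2 = ‖Ψ z - Ψ 0 * (I / (z + I))‖ * ‖z‖ := by
      rw [hG, norm_div]; field_simp
    have b : ‖z‖ ≤ ‖z + I‖ := by
      rw [← sq_le_sq₀ (by positivity) (by positivity)]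
      linarith [norm_sq_add_one_le_norm_add_I_sq hz]
    rw [e]
    calc _ ≤ (‖Ψ z‖ + ‖Ψ 0‖ * (1 / ‖z + I‖)) * ‖z‖ := by
          gcongr
          refine (norm_sub_le _ _).trans ?_
          simp
      _ = ‖Ψ z‖ * ‖z‖ + ‖Ψ 0‖ * (‖z‖ / ‖z + I‖) := by ring
      _ ≤ C + ‖Ψ 0‖ * 1 := by
          gcongr
          · exact hb z hz
          · exact (div_le_one hI).2 b
      _ = _ := by ring
  obtain ⟨i1, i2⟩ := integral_ofReal_eq_zero hGd hGc hG1 hG2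
  obtain ⟨i3, i4⟩ := integral_Ioi_add_comp_neg i1
  rw [i2] at i4
  have hq : IntegrableOn (fun s : ℝ => Ψ 0 * (2 * I) * (((1 + s ^ 2)⁻¹ : ℝ) : ℂ)) (Ioi 0) :=
    (integrable_inv_one_add_sq.integrableOn.ofReal).const_mul _
  have e : EqOn (fun s : ℝ => (Ψ s - Ψ (-s)) / s) (fun s : ℝ => (G s + G ((-s : ℝ) : ℂ)) +
      Ψ 0 * (2 * I) * (((1 + s ^ 2)⁻¹ : ℝ) : ℂ)) (Ioi 0) := by
    intro s hs
    have hs' : (s : ℂ) ≠ 0 := by exact_mod_cast (ne_of_gt hs)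
    have h1 : (s : ℂ) + I ≠ 0 := hzI s (by simp)
    have h2 : -(s : ℂ) + I ≠ 0 := by simpa using hzI (-s : ℝ) (by simp)
    have h3 : (1 + (s : ℂ) ^ 2) = -((s + I) * (-s + I)) := by linear_combination I_sq
    have h4 : (1 + (s : ℂ) ^ 2)⁻¹ = -(1 / ((s + I) * (-s + I))) := by
      rw [h3, inv_neg, one_div]
    simp only [hG]
    push_cast
    rw [h4]
    field_simp
    ring
  refine ⟨(integrableOn_congr_fun e measurableSet_Ioi).2 (i3.add hq), ?_⟩
  rw [setIntegral_congr_fun measurableSet_Ioi e, integral_add i3 hq, i4, zero_add,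
    integral_const_mul, integral_complex_ofReal, integral_Ioi_inv_one_add_sq]
  simp only [Real.arctan_zero, sub_zero]
  push_cast
  ring

/-- The half-residue formula at a double pole: `integral_Ioi_sub_div` for the divided difference of
`Ψ` at `0`. -/
lemma integral_Ioi_secondDiff_div {Ψ : ℂ → ℂ} {B : ℝ} (hd : DifferentiableOn ℂ Ψ {z | 0 < z.im})
    (hc : ContinuousOn Ψ {z | 0 ≤ z.im}) (hb : ∀ z : ℂ, 0 ≤ z.im → ‖Ψ z‖ ≤ B)
    (h0 : ∀ᶠ z in 𝓝 (0 : ℂ), DifferentiableAt ℂ Ψ z) :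
    IntegrableOn (fun s : ℝ => (Ψ s + Ψ (-s) - 2 * Ψ 0) / s ^ 2) (Ioi 0) ∧
      ∫ s in Ioi (0 : ℝ), (Ψ s + Ψ (-s) - 2 * Ψ 0) / s ^ 2 = Real.pi * I * deriv Ψ 0 := by
  have hB : 0 ≤ B := (norm_nonneg _).trans (hb 0 (by simp))
  set D := dslope Ψ 0 with hD
  have hsl : ∀ z : ℂ, z ≠ 0 → D z = (Ψ z - Ψ 0) / z := by
    intro z hz
    rw [hD, dslope_of_ne _ hz, slope_def_field, sub_zero]
  have hDd : DifferentiableOn ℂ D {z | 0 < z.im} :=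
    (differentiableOn_dslope_of_notMem (by simp)).2 hd
  have hD0 : DifferentiableAt ℂ D 0 := by
    have := (Complex.differentiableOn_dslope h0).2
      (fun z (hz : DifferentiableAt ℂ Ψ z) => hz.differentiableWithinAt)
    exact this.differentiableAt h0
  have hDc : ContinuousOn D {z | 0 ≤ z.im} := by
    intro z hz
    rcases eq_or_ne z 0 with rfl | hz0
    · exact hD0.continuousAt.continuousWithinAt
    · exact (continuousWithinAt_dslope_of_ne hz0).2 (hc z hz)
  have hDb : ∀ z : ℂ, 0 ≤ z.im → ‖D z‖ * ‖z‖ ≤ 2 * B := by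
    intro z hz
    rcases eq_or_ne z 0 with rfl | hz0
    · simp; positivity
    · rw [hsl z hz0, norm_div, div_mul_cancel₀ _ (norm_ne_zero_iff.2 hz0)]
      linarith [norm_sub_le (Ψ z) (Ψ 0), hb z hz, hb 0 (by simp)]
  obtain ⟨K, hK⟩ := hD0.isBigO_sub.bound
  obtain ⟨δ, hδ, hball⟩ := Metric.eventually_nhds_iff.1 hK
  have hDh : ∀ z : ℂ, 0 ≤ z.im → ‖D z - D 0‖ ≤
      max (2 * B) (|K| + (2 * B / min δ 1 + ‖D 0‖) / √(min δ 1)) * √‖z‖ := by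
    intro z hz
    have hδ1 : 0 < min δ 1 := lt_min hδ one_pos
    refine le_trans ?_ (mul_le_mul_of_nonneg_right (le_max_right _ _) (Real.sqrt_nonneg _))
    rcases lt_or_ge ‖z‖ (min δ 1) with h | h
    · have h1 := hball (y := z) (by simpa using h.trans_le (min_le_left _ _))
      rw [sub_zero] at h1
      have h2 : ‖z‖ ≤ √‖z‖ := by
        apply Real.le_sqrt_of_sq_le
        nlinarith [norm_nonneg z, h.trans_le (min_le_right _ _)]
      calc _ ≤ K * ‖z‖ := h1
        _ ≤ |K| * √‖z‖ := by
          gcongr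
          exact le_abs_self K
        _ ≤ _ := by
          gcongr
          have : 0 ≤ (2 * B / min δ 1 + ‖D 0‖) / √(min δ 1) := by positivity
          linarith
    · have hz' : 0 < ‖z‖ := hδ1.trans_le h
      have h1 : ‖D z‖ ≤ 2 * B / min δ 1 := by
        calc ‖D z‖ ≤ 2 * B / ‖z‖ := by
              rw [le_div_iff₀ hz']; exact hDb z hz
          _ ≤ _ := by gcongr
      calc ‖D z - D 0‖ ≤ (2 * B / min δ 1 + ‖D 0‖) * 1 := by
            linarith [norm_sub_le (D z) (D 0)]
        _ ≤ (2 * B / min δ 1 + ‖D 0‖) * (√‖z‖ / √(min δ 1)) := by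
            gcongr
            rw [one_le_div (Real.sqrt_pos.2 hδ1)]
            exact Real.sqrt_le_sqrt h
        _ = (2 * B / min δ 1 + ‖D 0‖) / √(min δ 1) * √‖z‖ := by ring
        _ ≤ _ := by
          gcongr
          linarith [abs_nonneg K]
  obtain ⟨i1, i2⟩ := integral_Ioi_sub_div hDd hDc (fun z hz => (hDb z hz).trans (le_max_left _ _)) hDh
  have e : EqOn (fun s : ℝ => (Ψ s + Ψ (-s) - 2 * Ψ 0) / s ^ 2)
      (fun s : ℝ => (D s - D (-s)) / s) (Ioi 0) := by
    intro s hs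
    have hs' : (s : ℂ) ≠ 0 := by exact_mod_cast (ne_of_gt hs)
    simp only
    rw [hsl _ hs', hsl _ (neg_ne_zero.2 hs')]
    field_simp
    ring
  refine ⟨(integrableOn_congr_fun e measurableSet_Ioi).2 i1, ?_⟩
  rw [setIntegral_congr_fun measurableSet_Ioi e, i2, hD, dslope_same]

/-! ### Principal values as absolutely convergent symmetrised integrals -/

/-- A principal value is the integral of the symmetrised integrand. Since `g` is `O(1 / |y|)`,
truncating at infinity symmetrically around `0` instead of `x` changes the integral only by
`O(1 / R)`. -/
lemma hasPVIntegral_of_integrableOn {g : ℝ → ℝ} {x C : ℝ} (hc : ContinuousOn g {x}ᶜ)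
    (hb : ∀ y, 1 ≤ |x - y| → |g y| * |x - y| ≤ C)
    (hi : IntegrableOn (fun s => g (x + s) + g (x - s)) (Ioi 0)) :
    HasPVIntegral g x (∫ s in Ioi (0 : ℝ), (g (x + s) + g (x - s))) := by
  set h : ℝ → ℝ := fun s => g (x + s) + g (x - s) with hh
  refine ⟨fun ε R hε => ?_, ?_⟩
  · refine ContinuousOn.integrableOn_compact ?_ (hc.mono ?_)
    · refine (isCompact_Icc (a := -R) (b := R)).of_isClosed_subset ?_ ?_
      · have c1 : IsClosed {y : ℝ | ε ≤ |y - x|} := isClosed_le (by fun_prop) (by fun_prop)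
        have c2 : IsClosed {y : ℝ | |y| ≤ R} := isClosed_le (by fun_prop) (by fun_prop)
        exact c1.inter c2
      · rintro y ⟨-, hy⟩
        exact abs_le.1 hy
    · rintro y ⟨hy, -⟩ rfl
      simp at hy
      linarith
  have c1 : ∀ a b : ℝ, 0 < a → 0 < b →
      IntervalIntegrable (fun s => g (x + s)) volume a b := by
    intro a b ha hb
    refine ContinuousOn.intervalIntegrable (hc.comp (by fun_prop) ?_)
    intro s hs
    have : 0 < s := (lt_min ha hb).trans_le hs.1
    simp [this.ne']
  have c2 : ∀ a b : ℝ, 0 < a → 0 < b →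
      IntervalIntegrable (fun s => g (x - s)) volume a b := by
    intro a b ha hb
    refine ContinuousOn.intervalIntegrable (hc.comp (by fun_prop) ?_)
    intro s hs
    have : 0 < s := (lt_min ha hb).trans_le hs.1
    simp [this.ne']
  have ch : ∀ a : ℝ, 0 ≤ a → IntervalIntegrable h volume 0 a := by
    intro a ha
    rw [intervalIntegrable_iff_integrableOn_Ioc_of_le ha]
    exact hi.mono_set fun s hs => hs.1
  have key : ∀ᶠ p : ℝ × ℝ in 𝓝[>] 0 ×ˢ atTop,
      (∫ y in {y : ℝ | p.1 ≤ |y - x| ∧ |y| ≤ p.2}, g y) =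
        ((∫ s in (0 : ℝ)..p.2, h s) - ∫ s in (0 : ℝ)..p.1, h s) +
          ((∫ s in p.2..(p.2 - x), g (x + s)) + ∫ s in p.2..(p.2 + x), g (x - s)) := by
    have e1 : ∀ᶠ p : ℝ × ℝ in 𝓝[>] (0 : ℝ) ×ˢ atTop, 0 < p.1 ∧ p.1 < 1 :=
      tendsto_fst.eventually (Ioo_mem_nhdsGT one_pos)
    have e2 : ∀ᶠ p : ℝ × ℝ in 𝓝[>] (0 : ℝ) ×ˢ atTop, |x| + 1 < p.2 :=
      tendsto_snd.eventually (eventually_gt_atTop (|x| + 1))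
    filter_upwards [e1, e2] with p hp hR
    obtain ⟨ε, R⟩ := p
    obtain ⟨hε, hε1⟩ := hp
    simp only at hε hε1 hR ⊢
    have hx1 := le_abs_self x
    have hx2 := neg_le_abs x
    have hx3 := abs_nonneg x
    have hset : {y : ℝ | ε ≤ |y - x| ∧ |y| ≤ R} = Icc (-R) (x - ε) ∪ Icc (x + ε) R := by
      ext y
      simp only [mem_ofPred_eq, mem_union, mem_Icc, abs_le, le_abs]
      constructor
      · rintro ⟨h1 | h1, h2, h3⟩
        · right; constructor <;> linarith
        · left; constructor <;> linarith
      · rintro (⟨h1, h2⟩ | ⟨h1, h2⟩)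
        · exact ⟨Or.inr (by linarith), by linarith, by linarith⟩
        · exact ⟨Or.inl (by linarith), by linarith, by linarith⟩
    have hdisj : Disjoint (Icc (-R) (x - ε)) (Icc (x + ε) R) := by
      rw [Set.disjoint_left]
      rintro y ⟨-, h1⟩ ⟨h2, -⟩
      linarith
    have i1 : IntegrableOn g (Icc (-R) (x - ε)) := by
      refine (hc.mono ?_).integrableOn_compact isCompact_Icc
      rintro y ⟨-, h1⟩ rfl
      linarith
    have i2 : IntegrableOn g (Icc (x + ε) R) := by
      refine (hc.mono ?_).integrableOn_compact isCompact_Icc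
      rintro y ⟨h1, -⟩ rfl
      linarith
    rw [hset, setIntegral_union hdisj measurableSet_Icc i1 i2, integral_Icc_eq_integral_Ioc,
      integral_Icc_eq_integral_Ioc, ← intervalIntegral.integral_of_le (by linarith),
      ← intervalIntegral.integral_of_le (by linarith)]
    have t1 : (∫ y in (-R)..(x - ε), g y) = ∫ s in ε..(R + x), g (x - s) := by
      rw [intervalIntegral.integral_comp_sub_left]
      congr 1; ring
    have t2 : (∫ y in (x + ε)..R, g y) = ∫ s in ε..(R - x), g (x + s) := by
      rw [intervalIntegral.integral_comp_add_left]
      congr 1; ring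
    rw [t1, t2, ← intervalIntegral.integral_add_adjacent_intervals (c2 ε R hε (by linarith))
      (c2 R (R + x) (by linarith) (by linarith)),
      ← intervalIntegral.integral_add_adjacent_intervals (c1 ε R hε (by linarith))
      (c1 R (R - x) (by linarith) (by linarith)),
      intervalIntegral.integral_interval_sub_left (ch R (by linarith)) (ch ε hε.le), hh,
      intervalIntegral.integral_add (c1 ε R hε (by linarith)) (c2 ε R hε (by linarith))]
    ring
  rw [tendsto_congr' key]
  have l1 : Tendsto (fun R : ℝ => ∫ s in (0 : ℝ)..R, h s) atTop (𝓝 (∫ s in Ioi 0, h s)) :=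
    intervalIntegral_tendsto_integral_Ioi 0 hi tendsto_id
  have l2 : Tendsto (fun ε : ℝ => ∫ s in (0 : ℝ)..ε, h s) (𝓝[>] 0) (𝓝 0) := by
    have i1 : IntegrableOn h (uIcc 0 1) := by
      rw [uIcc_of_le zero_le_one, integrableOn_Icc_iff_integrableOn_Ioc]
      exact hi.mono_set fun s hs => hs.1
    have := (intervalIntegral.continuousOn_primitive_interval i1) 0 left_mem_uIcc
    rw [ContinuousWithinAt, intervalIntegral.integral_same, uIcc_of_le zero_le_one] at this
    exact this.mono_left (nhdsWithin_le_of_mem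
      (mem_of_superset (Ioo_mem_nhdsGT one_pos) Ioo_subset_Icc_self))
  have hC : 0 ≤ C := by
    refine le_trans ?_ (hb (x + 1) (by simp))
    positivity
  have lb : Tendsto (fun R : ℝ => C / (R - |x|) * |x|) atTop (𝓝 0) := by
    have : Tendsto (fun R : ℝ => R - |x|) atTop atTop := tendsto_atTop_add_const_right _ _ tendsto_id
    simpa using (this.const_div_atTop C).mul_const |x|
  have l3 : Tendsto (fun R : ℝ => ∫ s in R..(R - x), g (x + s)) atTop (𝓝 0) := by
    refine squeeze_zero_norm' ?_ lb
    filter_upwards [eventually_ge_atTop (|x| + 1)] with R hR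
    refine (intervalIntegral.norm_integral_le_of_norm_le_const (C := C / (R - |x|)) ?_).trans
      (by simp)
    intro s hs
    have hs' : R - |x| < s := by
      refine lt_of_le_of_lt ?_ hs.1
      rw [le_inf_iff]
      constructor <;> linarith [le_abs_self x, abs_nonneg x]
    have h1 := hb (x + s) (by simp; exact le_trans (by linarith) (le_abs_self s))
    rw [Real.norm_eq_abs, le_div_iff₀ (by linarith)]
    refine le_trans ?_ h1
    gcongr
    simp only [sub_add_cancel_left, abs_neg]
    exact hs'.le.trans (le_abs_self s)
  have l4 : Tendsto (fun R : ℝ => ∫ s in R..(R + x), g (x - s)) atTop (𝓝 0) := by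
    refine squeeze_zero_norm' ?_ lb
    filter_upwards [eventually_ge_atTop (|x| + 1)] with R hR
    refine (intervalIntegral.norm_integral_le_of_norm_le_const (C := C / (R - |x|)) ?_).trans
      (by simp)
    intro s hs
    have hs' : R - |x| < s := by
      refine lt_of_le_of_lt ?_ hs.1
      rw [le_inf_iff]
      constructor <;> linarith [neg_abs_le x, abs_nonneg x]
    have h1 := hb (x - s) (by simp; exact le_trans (by linarith) (le_abs_self s))
    rw [Real.norm_eq_abs, le_div_iff₀ (by linarith)]
    refine le_trans ?_ h1
    gcongr
    simp only [sub_sub_cancel]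
    exact hs'.le.trans (le_abs_self s)
  have := ((l1.comp tendsto_snd).sub (l2.comp tendsto_fst)).add
    ((l3.add l4).comp (tendsto_snd (f := 𝓝[>] (0 : ℝ))))
  simpa using this

lemma hasHilbertTransformAt_of_integrableOn {u : ℝ → ℝ} {x C : ℝ} (hu : Continuous u)
    (hb : ∀ y, |u y| ≤ C) (hi : IntegrableOn (fun s => (u (x + s) - u (x - s)) / s) (Ioi 0)) :
    HasHilbertTransformAt u x
      (-(1 / Real.pi * ∫ s in Ioi (0 : ℝ), (u (x + s) - u (x - s)) / s)) := by
  have e : (fun s => u (x + s) / (x - (x + s)) + u (x - s) / (x - (x - s))) =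
      fun s => -((u (x + s) - u (x - s)) / s) := by
    funext s
    rw [sub_add_cancel_left, sub_sub_cancel, div_neg]
    ring
  have hpv := hasPVIntegral_of_integrableOn (g := fun y => u y / (x - y)) (x := x) (C := C) ?_ ?_ ?_
  · refine ⟨_, hpv, ?_⟩
    rw [e, integral_neg]
    ring
  · refine hu.continuousOn.div (by fun_prop) fun y hy => ?_
    exact sub_ne_zero.2 (Ne.symm hy)
  · intro y hy
    rw [abs_div, div_mul_cancel₀ _ (by linarith)]
    exact hb y
  · rw [e]
    exact hi.neg

lemma fracLaplacianConst_half : fracLaplacianConst (1 / 2) = 1 / Real.pi := by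
  have h1 : Real.Gamma (-(1 / 2)) = -2 * √Real.pi := by
    have := Real.Gamma_add_one (s := -(1 / 2)) (by norm_num)
    rw [show -(1 / 2) + 1 = (1 / 2 : ℝ) by norm_num, Real.Gamma_one_half_eq] at this
    linarith
  have h2 : (4 : ℝ) ^ (1 / 2 : ℝ) = 2 := by
    rw [← Real.sqrt_eq_rpow, show (4 : ℝ) = 2 ^ 2 by norm_num, Real.sqrt_sq (by norm_num)]
  have h3 : 0 ≤ √Real.pi := Real.sqrt_nonneg _
  rw [fracLaplacianConst, h1, h2, show (1 / 2 : ℝ) + 1 / 2 = 1 by norm_num, Real.Gamma_one,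
    abs_mul, abs_of_nonneg h3]
  have h4 : √Real.pi * (|(-2 : ℝ)| * √Real.pi) = 2 * Real.pi := by
    rw [abs_neg, abs_of_pos two_pos, mul_left_comm, Real.mul_self_sqrt Real.pi_pos.le]
  rw [h4]
  field_simp

lemma hasFracLaplacianAt_half_of_integrableOn {u : ℝ → ℝ} {x C : ℝ} (hu : Continuous u)
    (hb : ∀ y, |u y| ≤ C)
    (hi : IntegrableOn (fun s => (u (x + s) + u (x - s) - 2 * u x) / s ^ 2) (Ioi 0)) :
    HasFracLaplacianAt (1 / 2) u x
      (-(1 / Real.pi * ∫ s in Ioi (0 : ℝ), (u (x + s) + u (x - s) - 2 * u x) / s ^ 2)) := by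
  have hp : ∀ y : ℝ, |x - y| ^ (1 + 2 * (1 / 2) : ℝ) = (x - y) ^ 2 := by
    intro y
    rw [show (1 + 2 * (1 / 2) : ℝ) = (2 : ℕ) by norm_num, Real.rpow_natCast, sq_abs]
  have e : (fun s => (u x - u (x + s)) / |x - (x + s)| ^ (1 + 2 * (1 / 2) : ℝ) +
      (u x - u (x - s)) / |x - (x - s)| ^ (1 + 2 * (1 / 2) : ℝ)) =
      fun s => -((u (x + s) + u (x - s) - 2 * u x) / s ^ 2) := by
    funext s
    rw [hp, hp, sub_add_cancel_left, sub_sub_cancel, neg_sq]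
    ring
  have hpv := hasPVIntegral_of_integrableOn
    (g := fun y => (u x - u y) / |x - y| ^ (1 + 2 * (1 / 2) : ℝ)) (x := x) (C := 2 * C) ?_ ?_ ?_
  · refine ⟨_, hpv, ?_⟩
    rw [e, integral_neg, fracLaplacianConst_half]
    ring
  · simp only [hp]
    refine (continuous_const.sub hu).continuousOn.div (by fun_prop) fun y hy => ?_
    exact pow_ne_zero 2 (sub_ne_zero.2 (Ne.symm hy))
  · intro y hy
    have h0 : 0 < |x - y| := by linarith
    have h1 : |u x - u y| ≤ 2 * C := by linarith [abs_sub (u x) (u y), hb x, hb y]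
    simp only [hp]
    rw [← sq_abs (x - y), abs_div, abs_of_pos (pow_pos h0 2)]
    calc _ = |u x - u y| / |x - y| := by field_simp
      _ ≤ |u x - u y| := div_le_self (abs_nonneg _) hy
      _ ≤ _ := h1
  · rw [e]
    exact hi.neg

/-! ### Boundary values of holomorphic functions on the upper half-plane -/

lemma continuous_comp_ofReal {Φ : ℂ → ℂ} (hc : ContinuousOn Φ {z | 0 ≤ z.im}) :
    Continuous fun t : ℝ => Φ t :=
  hc.comp_continuous continuous_ofReal fun t => by simp

lemma map_div_ofReal (L : ℂ →L[ℝ] ℝ) (w : ℂ) (r : ℝ) : L (w / r) = L w / r := by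
  rw [div_eq_inv_mul w, ← ofReal_inv, ← real_smul, map_smul, smul_eq_mul, div_eq_inv_mul]

/-- Let `L` be a real linear functional on `ℂ`. On boundary values of holomorphic functions of the
upper half-plane, the Hilbert transform acts as multiplication by `-i`. -/
lemma hasHilbertTransformAt_boundary {Φ : ℂ → ℂ} {C : ℝ} (L : ℂ →L[ℝ] ℝ)
    (hd : DifferentiableOn ℂ Φ {z | 0 < z.im}) (hB : ∀ z : ℂ, 0 ≤ z.im → ‖Φ z‖ ≤ C)
    (hb : ∀ z : ℂ, 0 ≤ z.im → ‖Φ z‖ * ‖z‖ ≤ C)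
    (hc : ContinuousOn Φ {z | 0 ≤ z.im})
    (hh : ∀ z w : ℂ, 0 ≤ z.im → 0 ≤ w.im → ‖Φ z - Φ w‖ ≤ C * √‖z - w‖) (x : ℝ) :
    HasHilbertTransformAt (fun t => L (Φ t)) x (L (-I * Φ x)) := by
  have hC : 0 ≤ C := (norm_nonneg _).trans (hB 0 (by simp))
  obtain ⟨i1, i2⟩ := integral_Ioi_sub_div (Ψ := fun z => Φ (x + z)) (C := C + C * |x|)
    (hd.comp (by fun_prop) fun z hz => by simpa using hz)
    (hc.comp (by fun_prop) fun z hz => by simpa using hz) (fun z hz => by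
      have h1 : ‖z‖ ≤ ‖x + z‖ + |x| := by
        have := norm_sub_le (x + z) (x : ℂ)
        rw [add_sub_cancel_left] at this
        simpa using this
      calc _ ≤ ‖Φ (x + z)‖ * (‖x + z‖ + |x|) := by gcongr
        _ = ‖Φ (x + z)‖ * ‖x + z‖ + ‖Φ (x + z)‖ * |x| := by ring
        _ ≤ _ := by
          gcongr
          · exact hb _ (by simpa using hz)
          · exact hB _ (by simpa using hz))
    (fun z hz => by
      refine (hh (x + z) (x + 0) (by simpa using hz) (by simp)).trans ?_
      rw [add_sub_add_left_eq_sub, sub_zero]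
      gcongr
      have := mul_nonneg hC (abs_nonneg x)
      linarith)
  rw [add_zero] at i2
  have e : (fun s : ℝ => (L (Φ (x + s : ℝ)) - L (Φ (x - s : ℝ))) / s) =
      fun s : ℝ => L ((Φ (x + s) - Φ (x + -s)) / s) := by
    funext s
    rw [map_div_ofReal, map_sub, ofReal_add, ofReal_sub, ← sub_eq_add_neg]
  have key := hasHilbertTransformAt_of_integrableOn (u := fun t => L (Φ t)) (x := x)
    (C := ‖L‖ * C) (L.continuous.comp (continuous_comp_ofReal hc))
    (fun y => (L.le_opNorm _).trans (by gcongr; exact hB _ (by simp)))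
    (by rw [e]; exact L.integrable_comp i1)
  convert key using 1
  rw [e, L.integral_comp_comm i1, i2, ← smul_eq_mul (1 / Real.pi), ← map_smul, ← map_neg,
    real_smul]
  congr 1
  have := Real.pi_ne_zero
  push_cast
  have : (Real.pi : ℂ) ≠ 0 := by exact_mod_cast this
  field_simp

/-- On boundary values of holomorphic functions of the upper half-plane, the half-Laplacian acts as
`-i` times the complex derivative. Stated for the symmetrised integral. -/
lemma integral_secondDiff_boundary {Φ : ℂ → ℂ} {C : ℝ} (L : ℂ →L[ℝ] ℝ)
    (hd : DifferentiableOn ℂ Φ {z | 0 < z.im}) (hB : ∀ z : ℂ, 0 ≤ z.im → ‖Φ z‖ ≤ C)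
    (hc : ContinuousOn Φ {z | 0 ≤ z.im}) {x : ℝ}
    (hx : ∀ᶠ z in 𝓝 (x : ℂ), DifferentiableAt ℂ Φ z) :
    IntegrableOn (fun s : ℝ => (L (Φ (x + s : ℝ)) + L (Φ (x - s : ℝ)) - 2 * L (Φ x)) / s ^ 2)
      (Ioi 0) ∧
    -(1 / Real.pi * ∫ s in Ioi (0 : ℝ),
      (L (Φ (x + s : ℝ)) + L (Φ (x - s : ℝ)) - 2 * L (Φ x)) / s ^ 2) = L (-I * deriv Φ x) := by
  have hshift : Tendsto (fun z : ℂ => (x : ℂ) + z) (𝓝 0) (𝓝 x) := by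
    have : ContinuousAt (fun z : ℂ => (x : ℂ) + z) 0 := by fun_prop
    simpa [ContinuousAt] using this
  obtain ⟨i1, i2⟩ := integral_Ioi_secondDiff_div (Ψ := fun z => Φ (x + z)) (B := C)
    (hd.comp (by fun_prop) fun z hz => by simpa using hz)
    (hc.comp (by fun_prop) fun z hz => by simpa using hz) (fun z hz => hB _ (by simpa using hz))
    ((hshift.eventually hx).mono fun z hz => hz.comp z (by fun_prop))
  rw [deriv_comp_const_add, add_zero] at i2
  rw [add_zero] at i1
  have e : (fun s : ℝ => (L (Φ (x + s : ℝ)) + L (Φ (x - s : ℝ)) - 2 * L (Φ x)) / s ^ 2) =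
      fun s : ℝ => L ((Φ (x + s) + Φ (x + -s) - 2 * Φ x) / s ^ 2) := by
    funext s
    rw [← ofReal_pow, map_div_ofReal, map_sub, map_add, ofReal_add, ofReal_sub, ← sub_eq_add_neg,
      show (2 : ℂ) * Φ x = (2 : ℝ) • Φ x by simp [real_smul], map_smul, smul_eq_mul]
  rw [e]
  refine ⟨L.integrable_comp i1, ?_⟩
  rw [L.integral_comp_comm i1, i2, ← smul_eq_mul (1 / Real.pi), ← map_smul, ← map_neg,
    real_smul]
  congr 1
  have := Real.pi_ne_zero
  push_cast
  have : (Real.pi : ℂ) ≠ 0 := by exact_mod_cast this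
  field_simp

lemma hasFracLaplacianAt_boundary {Φ : ℂ → ℂ} {C : ℝ} (L : ℂ →L[ℝ] ℝ)
    (hd : DifferentiableOn ℂ Φ {z | 0 < z.im}) (hB : ∀ z : ℂ, 0 ≤ z.im → ‖Φ z‖ ≤ C)
    (hc : ContinuousOn Φ {z | 0 ≤ z.im}) {x : ℝ}
    (hx : ∀ᶠ z in 𝓝 (x : ℂ), DifferentiableAt ℂ Φ z) :
    HasFracLaplacianAt (1 / 2) (fun t => L (Φ t)) x (L (-I * deriv Φ x)) := by
  obtain ⟨i1, i2⟩ := integral_secondDiff_boundary L hd hB hc hx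
  rw [← i2]
  exact hasFracLaplacianAt_half_of_integrableOn (u := fun t => L (Φ t)) (C := ‖L‖ * C)
    (L.continuous.comp (continuous_comp_ofReal hc))
    (fun y => (L.le_opNorm _).trans (by gcongr; exact hB _ (by simp))) i1

/-! ### The half-Laplacian of Schwartz functions and its symmetry -/

/-- The symmetric second difference of `u` at `x` with step `s`. -/
def secondDiff (u : ℝ → ℝ) (x s : ℝ) : ℝ := u (x + s) + u (x - s) - 2 * u x

/-- The half-Laplacian `(-Δ)^{1/2} u (x)` as an integral of second differences. -/
noncomputable def halfLaplacian (u : ℝ → ℝ) (x : ℝ) : ℝ :=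
  -(1 / Real.pi * ∫ s in Ioi (0 : ℝ), secondDiff u x s / s ^ 2)

lemma abs_secondDiff_le {u u' u'' : ℝ → ℝ} {K x s : ℝ} (hs : 0 ≤ s)
    (h1 : ∀ y, HasDerivAt u (u' y) y) (h2 : ∀ y, HasDerivAt u' (u'' y) y)
    (hK : ∀ y, |y - x| ≤ s → |u'' y| ≤ K) : |secondDiff u x s| ≤ 2 * K * s ^ 2 := by
  have hK0 : 0 ≤ K := (abs_nonneg _).trans (hK x (by simpa using hs))
  have hg : ∀ t, HasDerivAt (fun t => u (x + t) + u (x - t) - 2 * u x) (u' (x + t) - u' (x - t))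
      t := by
    intro t
    have a1 := (h1 (x + t)).comp_const_add x t
    have a2 := (h1 (x - t)).comp_const_sub x t
    exact ((a1.add a2).sub_const _).congr_deriv (by ring)
  have hb : ∀ t ∈ Icc 0 s, ‖u' (x + t) - u' (x - t)‖ ≤ 2 * K * s := by
    intro t ht
    have := (convex_Icc (x - t) (x + t)).norm_image_sub_le_of_norm_hasDerivWithin_le (f := u')
      (f' := u'') (C := K) (fun y _ => (h2 y).hasDerivWithinAt)
      (fun y hy => hK y (abs_le.2 ⟨by linarith [hy.1, ht.2], by linarith [hy.2, ht.2]⟩))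
      (x := x - t) (y := x + t) ⟨le_rfl, by linarith [ht.1]⟩ ⟨by linarith [ht.1], le_rfl⟩
    refine this.trans ?_
    rw [show x + t - (x - t) = 2 * t by ring, Real.norm_of_nonneg (by linarith [ht.1])]
    nlinarith [ht.2]
  have := (convex_Icc 0 s).norm_image_sub_le_of_norm_hasDerivWithin_le
    (fun t _ => (hg t).hasDerivWithinAt) hb (x := 0) (y := s) ⟨le_rfl, hs⟩ ⟨hs, le_rfl⟩
  rw [show ‖s - 0‖ = s by rw [sub_zero, Real.norm_of_nonneg hs]] at this
  calc |secondDiff u x s| = ‖(u (x + s) + u (x - s) - 2 * u x) -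
        (u (x + 0) + u (x - 0) - 2 * u x)‖ := by
        rw [Real.norm_eq_abs, secondDiff]; congr 1; simp; ring
    _ ≤ 2 * K * s * s := this
    _ = _ := by ring

lemma abs_secondDiff_div_sq_le {u : ℝ → ℝ} {C K x s : ℝ} (hs : 0 < s) (hC : ∀ y, |u y| ≤ C)
    (hK : |secondDiff u x s| ≤ K * s ^ 2) :
    |secondDiff u x s / s ^ 2| ≤ (K + 4 * C) * (2 * (1 + s ^ 2)⁻¹) := by
  have hC0 : 0 ≤ C := (abs_nonneg _).trans (hC 0)
  have hs2 : 0 < s ^ 2 := by positivity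
  have hK0 : 0 ≤ K := by
    by_contra h
    push Not at h
    nlinarith [abs_nonneg (secondDiff u x s)]
  have h4 : |secondDiff u x s| ≤ 4 * C := by
    unfold secondDiff
    have a1 := abs_le.1 (hC (x + s))
    have a2 := abs_le.1 (hC (x - s))
    have a3 := abs_le.1 (hC x)
    exact abs_le.2 ⟨by linarith, by linarith⟩
  rw [abs_div, abs_of_pos hs2, div_le_iff₀ hs2]
  have e : (K + 4 * C) * (2 * (1 + s ^ 2)⁻¹) * s ^ 2 = (K + 4 * C) * (2 * s ^ 2) / (1 + s ^ 2) := by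
    field_simp
  rw [e, le_div_iff₀ (by positivity)]
  nlinarith

lemma integrableOn_secondDiff_div_sq {u : ℝ → ℝ} {C K x : ℝ} (hu : Measurable u)
    (hC : ∀ y, |u y| ≤ C) (hK : ∀ s, 0 < s → |secondDiff u x s| ≤ K * s ^ 2) :
    IntegrableOn (fun s => secondDiff u x s / s ^ 2) (Ioi 0) := by
  refine ((integrable_inv_one_add_sq.const_mul 2).const_mul (K + 4 * C)).integrableOn.mono'
    (Measurable.aestronglyMeasurable ?_) ?_
  · unfold secondDiff
    fun_prop
  · rw [ae_restrict_iff' measurableSet_Ioi]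
    exact .of_forall fun s hs => abs_secondDiff_div_sq_le hs hC (hK s hs)

/-- Inverse quadratic decay, also of the second differences for small steps: the properties of a
Schwartz function that make its half-Laplacian integrable. -/
lemma schwartz_bounds (φ : SchwartzMap ℝ ℝ) : ∃ C : ℝ, (∀ x, |φ x| ≤ C) ∧
    (∀ x s, 0 < s → |secondDiff φ x s| ≤ C * s ^ 2) ∧
    ∀ x s, 0 < s → s ≤ 1 → |secondDiff φ x s| ≤ C * (1 + x ^ 2)⁻¹ * s ^ 2 := by
  set φ2 := SchwartzMap.derivCLM ℝ ℝ (SchwartzMap.derivCLM ℝ ℝ φ) with hφ2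
  have hd1 : ∀ y, HasDerivAt φ (SchwartzMap.derivCLM ℝ ℝ φ y) y := fun y => φ.hasDerivAt y
  have hd2 : ∀ y, HasDerivAt (SchwartzMap.derivCLM ℝ ℝ φ) (φ2 y) y :=
    fun y => (SchwartzMap.derivCLM ℝ ℝ φ).hasDerivAt y
  obtain ⟨A, hA, hA'⟩ := φ.decay 0 0
  obtain ⟨C0, h0, h0'⟩ := φ2.decay 0 0
  obtain ⟨C2, h2, h2'⟩ := φ2.decay 2 0
  simp only [norm_iteratedFDeriv_zero, pow_zero, one_mul, Real.norm_eq_abs, sq_abs] at hA' h0' h2'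
  refine ⟨A + 6 * (C0 + C2), fun x => ?_, fun x s hs => ?_, fun x s hs hs1 => ?_⟩
  · linarith [hA' x]
  · refine (abs_secondDiff_le hs.le hd1 hd2 (K := C0) fun y _ => h0' y).trans ?_
    gcongr
    linarith
  · refine (abs_secondDiff_le hs.le hd1 hd2 (K := 3 * (C0 + C2) * (1 + x ^ 2)⁻¹)
      fun y hy => ?_).trans ?_
    · rw [← div_eq_mul_inv, le_div_iff₀ (by positivity)]
      have hxy : 1 + x ^ 2 ≤ 3 * (1 + y ^ 2) := by
        have := abs_le.1 (hy.trans hs1)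
        nlinarith [sq_nonneg (2 * y - x), sq_nonneg y]
      calc |φ2 y| * (1 + x ^ 2) ≤ |φ2 y| * (3 * (1 + y ^ 2)) := by gcongr
        _ = 3 * (|φ2 y| + y ^ 2 * |φ2 y|) := by ring
        _ ≤ 3 * (C0 + C2) := by
          have := h0' y
          have := h2' y
          linarith
    · have : 0 ≤ (1 + x ^ 2)⁻¹ * s ^ 2 := by positivity
      nlinarith

lemma hasFracLaplacianAt_schwartz (φ : SchwartzMap ℝ ℝ) (x : ℝ) :
    HasFracLaplacianAt (1 / 2) φ x (halfLaplacian φ x) := by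
  obtain ⟨C, h1, h2, -⟩ := schwartz_bounds φ
  exact hasFracLaplacianAt_half_of_integrableOn φ.continuous h1
    (integrableOn_secondDiff_div_sq φ.continuous.measurable h1 (h2 x))

lemma integrable_mul_comp_sub {f g : ℝ → ℝ} (hf : Integrable f) (hg : Integrable g) :
    Integrable (fun p : ℝ × ℝ => f p.2 * g (p.1 - p.2)) (volume.prod volume) :=
  hf.convolution_integrand (ContinuousLinearMap.mul ℝ ℝ) hg

lemma integrable_mul_comp_add {f g : ℝ → ℝ} (hf : Integrable f) (hg : Integrable g) :
    Integrable (fun p : ℝ × ℝ => f p.2 * g (p.1 + p.2)) (volume.prod volume) := by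
  have h := integrable_mul_comp_sub hf.comp_neg hg
  have hm : MeasurePreserving (Prod.map id Neg.neg : ℝ × ℝ → ℝ × ℝ) (volume.prod volume)
      (volume.prod volume) :=
    (MeasurePreserving.id volume).prod (Measure.measurePreserving_neg volume)
  have := hm.integrable_comp_of_integrable h
  refine this.congr (.of_forall fun p => ?_)
  simp [Prod.map]

lemma integrable_secondDiff_schwartz (φ : SchwartzMap ℝ ℝ) :
    Integrable (fun p : ℝ × ℝ => secondDiff φ p.1 p.2 / p.2 ^ 2)
      (volume.prod (volume.restrict (Ioi 0))) := by
  obtain ⟨C, h1, -, h3⟩ := schwartz_bounds φ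
  have hC : 0 ≤ C := (abs_nonneg _).trans (h1 0)
  have hw : Integrable (fun s : ℝ => 2 * (1 + s ^ 2)⁻¹) := integrable_inv_one_add_sq.const_mul 2
  have hφ : Integrable (fun x => |φ x|) := φ.integrable.abs
  have m1 := ((integrable_inv_one_add_sq.const_mul C).mul_prod hw)
  have m2 := integrable_mul_comp_add hw hφ
  have m3 := integrable_mul_comp_sub hw hφ
  have m4 := (hφ.const_mul 2).mul_prod hw
  have m := ((m1.add m2).add m3).add m4
  have hsub : volume.prod (volume.restrict (Ioi (0 : ℝ))) =
      ((volume : Measure ℝ).prod volume).restrict (univ ×ˢ Ioi 0) := by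
    rw [← Measure.prod_restrict, Measure.restrict_univ]
  rw [hsub]
  refine m.restrict.mono' (Measurable.aestronglyMeasurable ?_) ?_
  · have := φ.continuous.measurable
    unfold secondDiff
    fun_prop
  · rw [ae_restrict_iff' (MeasurableSet.univ.prod measurableSet_Ioi)]
    refine .of_forall fun p hp => ?_
    obtain ⟨x, s⟩ := p
    have hs : 0 < s := hp.2
    have hs2 : 0 < s ^ 2 := by positivity
    simp only [Pi.add_apply, Real.norm_eq_abs]
    set w := 2 * (1 + s ^ 2)⁻¹ with hwdef
    have hw0 : 0 ≤ w := by positivity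
    rw [abs_div, abs_of_pos hs2, div_le_iff₀ hs2]
    rcases le_or_gt s 1 with hs1 | hs1
    · have hw1 : 1 ≤ w := by
        rw [hwdef, ← div_eq_mul_inv, le_div_iff₀ (by positivity)]
        nlinarith
      have : 0 ≤ w * |φ (x + s)| + w * |φ (x - s)| + 2 * |φ x| * w := by positivity
      calc |secondDiff φ x s| ≤ C * (1 + x ^ 2)⁻¹ * s ^ 2 := h3 x s hs hs1
        _ ≤ C * (1 + x ^ 2)⁻¹ * w * s ^ 2 := by
          exact mul_le_mul_of_nonneg_right (le_mul_of_one_le_right (by positivity) hw1) hs2.le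
        _ ≤ _ := by
          gcongr
          linarith
    · have hw1 : 1 ≤ w * s ^ 2 := by
        rw [hwdef, ← div_eq_mul_inv, div_mul_eq_mul_div, le_div_iff₀ (by positivity)]
        nlinarith
      have b : |secondDiff φ x s| ≤ |φ (x + s)| + |φ (x - s)| + 2 * |φ x| := by
        unfold secondDiff
        refine (abs_sub _ _).trans (add_le_add (abs_add_le _ _) ?_)
        rw [abs_mul, abs_two]
      have hn : 0 ≤ C * (1 + x ^ 2)⁻¹ * w := by positivity
      calc |secondDiff φ x s| ≤ |φ (x + s)| + |φ (x - s)| + 2 * |φ x| := b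
        _ ≤ (|φ (x + s)| + |φ (x - s)| + 2 * |φ x|) * (w * s ^ 2) :=
          le_mul_of_one_le_right (by positivity) hw1
        _ = (w * |φ (x + s)| + w * |φ (x - s)| + 2 * |φ x| * w) * s ^ 2 := by ring
        _ ≤ _ := by
          gcongr
          linarith

lemma integrable_halfLaplacian_schwartz (φ : SchwartzMap ℝ ℝ) : Integrable (halfLaplacian φ) :=
  ((integrable_secondDiff_schwartz φ).integral_prod_left.const_mul (1 / Real.pi)).neg

/-- Translation invariance moves the second difference onto the other factor. -/
lemma integral_mul_secondDiff {u φ : ℝ → ℝ} {C : ℝ} (hu : Measurable u) (hC : ∀ y, |u y| ≤ C)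
    (hφ : Integrable φ) (s : ℝ) :
    ∫ x, u x * secondDiff φ x s = ∫ x, φ x * secondDiff u x s := by
  have hm : ∀ c : ℝ, AEStronglyMeasurable (fun x => u (x + c)) :=
    fun c => (hu.comp (measurable_id.add_const c)).aestronglyMeasurable
  have i1 : ∀ c d : ℝ, Integrable fun x => u (x + c) * φ (x + d) := fun c d =>
    (hφ.comp_add_right d).bdd_mul (c := C) (hm c) (.of_forall fun x => hC _)
  have t1 : ∫ x, u (x + 0) * φ (x + s) = ∫ x, u (x + -s) * φ (x + 0) := by
    rw [← integral_add_right_eq_self _ (-s)]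
    congr 1; funext x; congr 2 <;> ring
  have t2 : ∫ x, u (x + 0) * φ (x + -s) = ∫ x, u (x + s) * φ (x + 0) := by
    rw [← integral_add_right_eq_self _ s]
    congr 1; funext x; congr 2 <;> ring
  have e1 : (fun x => u x * secondDiff φ x s) = fun x => u (x + 0) * φ (x + s) +
      u (x + 0) * φ (x + -s) - 2 * (u (x + 0) * φ (x + 0)) := by
    funext x; simp only [secondDiff, add_zero, sub_eq_add_neg]; ring
  have e2 : (fun x => φ x * secondDiff u x s) = fun x => u (x + s) * φ (x + 0) +
      u (x + -s) * φ (x + 0) - 2 * (u (x + 0) * φ (x + 0)) := by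
    funext x; simp only [secondDiff, add_zero, sub_eq_add_neg]; ring
  have split : ∀ {f g h : ℝ → ℝ}, Integrable f → Integrable g → Integrable h →
      ∫ x, (f x + g x - 2 * h x) = (∫ x, f x) + (∫ x, g x) - 2 * ∫ x, h x := by
    intro f g h hf hg hh
    have := integral_sub (hf.add hg) (hh.const_mul 2)
    simp only [Pi.add_apply] at this
    rw [this, integral_add hf hg, integral_const_mul]
  rw [e1, e2, split (i1 _ _) (i1 _ _) (i1 _ _), split (i1 _ _) (i1 _ _) (i1 _ _), t1, t2]
  ring

/-- The half-Laplacian is symmetric: Fubini's theorem for the second differences. -/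
lemma integral_mul_halfLaplacian {u : ℝ → ℝ} {C K : ℝ} (hu : Measurable u) (hC : ∀ y, |u y| ≤ C)
    (hK : ∀ x s, 0 < s → |secondDiff u x s| ≤ K * s ^ 2) (φ : SchwartzMap ℝ ℝ) :
    ∫ x, u x * halfLaplacian φ x = ∫ x, φ x * halfLaplacian u x := by
  have i1 : Integrable (Function.uncurry fun x s => u x * (secondDiff φ x s / s ^ 2))
      (volume.prod (volume.restrict (Ioi 0))) :=
    (integrable_secondDiff_schwartz φ).bdd_mul (c := C)
      (hu.comp measurable_fst).aestronglyMeasurable (.of_forall fun p => hC _)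
  have i2 : Integrable (Function.uncurry fun x s => φ x * (secondDiff u x s / s ^ 2))
      (volume.prod (volume.restrict (Ioi 0))) := by
    have hw : Integrable (fun s : ℝ => (K + 4 * C) * (2 * (1 + s ^ 2)⁻¹)) :=
      (integrable_inv_one_add_sq.const_mul 2).const_mul (K + 4 * C)
    have m := (φ.integrable (μ := volume)).abs.mul_prod (hw.restrict (s := Ioi (0 : ℝ)))
    refine m.mono' (Measurable.aestronglyMeasurable ?_) ?_
    · have := φ.continuous.measurable
      unfold secondDiff Function.uncurry
      fun_prop
    · have hsub : volume.prod (volume.restrict (Ioi (0 : ℝ))) =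
          ((volume : Measure ℝ).prod volume).restrict (univ ×ˢ Ioi 0) := by
        rw [← Measure.prod_restrict, Measure.restrict_univ]
      rw [hsub, ae_restrict_iff' (MeasurableSet.univ.prod measurableSet_Ioi)]
      refine .of_forall fun p hp => ?_
      simp only [Function.uncurry, norm_mul, Real.norm_eq_abs]
      gcongr
      exact abs_secondDiff_div_sq_le hp.2 hC (hK _ _ hp.2)
  have key : ∫ x, u x * ∫ s in Ioi (0 : ℝ), secondDiff φ x s / s ^ 2 =
      ∫ x, φ x * ∫ s in Ioi (0 : ℝ), secondDiff u x s / s ^ 2 := by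
    simp only [← integral_const_mul]
    rw [integral_integral_swap i1, integral_integral_swap i2]
    congr 1
    funext s
    simp only [← mul_div_assoc, integral_div]
    rw [integral_mul_secondDiff hu hC φ.integrable]
  have e : ∀ v w : ℝ → ℝ, (fun x => v x * halfLaplacian w x) = fun x =>
      (-(1 / Real.pi)) * (v x * ∫ s in Ioi (0 : ℝ), secondDiff w x s / s ^ 2) := by
    intro v w; funext x; unfold halfLaplacian; ring
  rw [e, e, integral_const_mul, integral_const_mul, key]

/-! ### The half-Laplacian of boundary values in the sense of distributions -/

/-- On the line `Im z = ε` the Cauchy estimates bound the second derivative of `Φ`. -/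
lemma abs_secondDiff_boundary_le {Φ : ℂ → ℂ} {C ε : ℝ} (L : ℂ →L[ℝ] ℝ) (hε : 0 < ε)
    (hd : DifferentiableOn ℂ Φ {z | 0 < z.im}) (hB : ∀ z : ℂ, 0 ≤ z.im → ‖Φ z‖ ≤ C)
    (x s : ℝ) (hs : 0 < s) :
    |secondDiff (fun t : ℝ => L (Φ (t + ε * I))) x s| ≤
      2 * (‖L‖ * (2 * C / (ε / 2) ^ 2)) * s ^ 2 := by
  have hopen : IsOpen {z : ℂ | 0 < z.im} := isOpen_lt continuous_const continuous_im
  have hmem : ∀ y : ℝ, (y + ε * I : ℂ) ∈ {z : ℂ | 0 < z.im} := fun y => by simpa using hε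
  have hd' : DifferentiableOn ℂ (deriv Φ) {z | 0 < z.im} := hd.deriv hopen
  have comp : ∀ {F : ℂ → ℂ}, DifferentiableOn ℂ F {z | 0 < z.im} → ∀ y : ℝ,
      HasDerivAt (fun t : ℝ => L (F (t + ε * I))) (L (deriv F (y + ε * I))) y := by
    intro F hF y
    have h1 := (hF.differentiableAt (hopen.mem_nhds (hmem y))).hasDerivAt
    have h2 := (HasDerivAt.comp_add_const (y : ℂ) (ε * I) h1).comp_ofReal
    exact L.hasFDerivAt.comp_hasDerivAt y h2
  refine abs_secondDiff_le hs.le (comp hd) (comp hd') fun y _ => ?_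
  refine (L.le_opNorm _).trans (mul_le_mul_of_nonneg_left ?_ (norm_nonneg _))
  have hball : Metric.closedBall (y + ε * I : ℂ) (ε / 2) ⊆ {z | 0 < z.im} := by
    intro z hz
    have h1 := (Complex.abs_im_le_norm (z - (y + ε * I))).trans (mem_closedBall_iff_norm.1 hz)
    have h2 := (abs_le.1 h1).1
    simp only [sub_im, add_im, ofReal_im, mul_im, ofReal_re, I_im, mul_one, I_re, mul_zero,
      add_zero, zero_add] at h2
    show 0 < z.im
    linarith
  have hcl : DiffContOnCl ℂ Φ (Metric.ball (y + ε * I : ℂ) (ε / 2)) := by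
    refine DifferentiableOn.diffContOnCl (hd.mono ?_)
    rw [closure_ball _ (by positivity)]
    exact hball
  have := norm_iteratedDeriv_le_of_forall_mem_sphere_norm_le 2 (by positivity) hcl
    (C := C) fun z hz => hB z (le_of_lt (hball (Metric.sphere_subset_closedBall hz)))
  simpa [iteratedDeriv_succ] using this

/-- The half-Laplacian of boundary values in the sense of distributions. The symmetry of the
half-Laplacian applies on the horizontal lines `Im z = ε`, where `Φ` is smooth; the limit `ε → 0`
is dominated. -/
lemma hasDistribFracLaplacian_boundary {Φ : ℂ → ℂ} {C : ℝ} (L : ℂ →L[ℝ] ℝ)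
    (hd : DifferentiableOn ℂ Φ {z | 0 < z.im}) (hB : ∀ z : ℂ, 0 ≤ z.im → ‖Φ z‖ ≤ C)
    (hc : ContinuousOn Φ {z | 0 ≤ z.im})
    (hx : ∀ᵐ x : ℝ, ∀ᶠ z in 𝓝 (x : ℂ), DifferentiableAt ℂ Φ z) {g : ℝ → ℝ}
    (hdom : ∀ᵐ x : ℝ, ∀ ε : ℝ, 0 ≤ ε → ‖deriv Φ (x + ε * I)‖ ≤ g x)
    (hg : ∀ φ : SchwartzMap ℝ ℝ, Integrable fun x => g x * φ x) {f : ℝ → ℝ}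
    (hf : ∀ᵐ x : ℝ, f x = L (-I * deriv Φ x)) :
    HasDistribFracLaplacian (1 / 2) (fun t => L (Φ t)) f := by
  intro φ
  have hLC : ∀ z : ℂ, 0 ≤ z.im → |L (Φ z)| ≤ ‖L‖ * C := fun z hz =>
    (L.le_opNorm _).trans (by gcongr; exact hB z hz)
  have hψ := integrable_halfLaplacian_schwartz φ
  have hu : Continuous fun t : ℝ => L (Φ t) := L.continuous.comp (continuous_comp_ofReal hc)
  have hline : ∀ ε : ℝ, 0 ≤ ε → Continuous fun t : ℝ => L (Φ (t + ε * I)) := fun ε hε =>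
    L.continuous.comp (hc.comp_continuous (by fun_prop) fun t => by simpa using hε)
  have hmeas : ∀ ε : ℝ, AEStronglyMeasurable fun x : ℝ => L (-I * deriv Φ (x + ε * I)) * φ x := by
    intro ε
    have h1 : Measurable fun x : ℝ => deriv Φ (x + ε * I) :=
      (measurable_deriv Φ).comp (by fun_prop)
    exact ((L.continuous.measurable.comp (h1.const_mul (-I))).mul
      φ.continuous.measurable).aestronglyMeasurable
  have hbd : ∀ᵐ x : ℝ, ∀ ε : ℝ, 0 ≤ ε →
      ‖L (-I * deriv Φ (x + ε * I)) * φ x‖ ≤ ‖L‖ * ‖g x * φ x‖ := by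
    filter_upwards [hdom] with x hx ε hε
    rw [norm_mul, norm_mul, ← mul_assoc]
    gcongr
    refine (L.le_opNorm _).trans ?_
    rw [norm_mul, norm_neg, norm_I, one_mul]
    gcongr
    exact (hx ε hε).trans (le_abs_self _)
  have hfφ : (fun x => f x * φ x) =ᵐ[volume] fun x : ℝ => L (-I * deriv Φ x) * φ x := by
    filter_upwards [hf] with x hx
    rw [hx]
  refine ⟨halfLaplacian φ, hasFracLaplacianAt_schwartz φ,
    hψ.bdd_mul (c := ‖L‖ * C) hu.aestronglyMeasurable
      (.of_forall fun x => hLC x (by simp)), ?_, ?_⟩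
  · refine Integrable.congr ?_ hfφ.symm
    refine ((hg φ).norm.const_mul ‖L‖).mono' ?_ ?_
    · simpa using hmeas 0
    · filter_upwards [hbd] with x hx
      simpa using hx 0 le_rfl
  · rw [integral_congr_ae hfφ]
    have hline_eq : ∀ ε : ℝ, 0 < ε → ∫ x : ℝ, L (-I * deriv Φ (x + ε * I)) * φ x =
        ∫ x : ℝ, L (Φ (x + ε * I)) * halfLaplacian φ x := by
      intro ε hε
      rw [integral_mul_halfLaplacian (hline ε hε.le).measurable
        (fun y => hLC _ (by simpa using hε.le))
        (fun x s hs => abs_secondDiff_boundary_le L hε hd hB x s hs) φ]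
      congr 1
      funext x
      have hopen : IsOpen {z : ℂ | -ε < z.im} := isOpen_lt continuous_const continuous_im
      have hdε : DifferentiableOn ℂ (fun z => Φ (z + ε * I)) {z | -ε < z.im} :=
        hd.comp (by fun_prop) fun z hz => by
          simp only [mem_ofPred_eq, add_im, mul_im, ofReal_re, I_im, mul_one, ofReal_im, I_re,
            mul_zero, add_zero] at hz ⊢
          linarith
      have h := (integral_secondDiff_boundary (Φ := fun z => Φ (z + ε * I)) (C := C) (x := x) L
        (hdε.mono fun z hz => by
          simp only [mem_ofPred_eq] at hz ⊢
          linarith)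
        (fun z hz => hB _ (by simp; linarith))
        (hdε.continuousOn.mono fun z hz => by
          simp only [mem_ofPred_eq] at hz ⊢
          linarith)
        ((hopen.eventually_mem (by simpa using hε)).mono fun z hz =>
          hdε.differentiableAt (hopen.mem_nhds hz))).2
      rw [deriv_comp_add_const] at h
      rw [← h, mul_comm]
      rfl
    have hpos : ∀ n : ℕ, (0 : ℝ) < 1 / ((n : ℝ) + 1) := fun n => by positivity
    have him : ∀ (n : ℕ) (x : ℝ), 0 ≤ (x + (1 / ((n : ℝ) + 1) : ℝ) * I : ℂ).im := fun n x => by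
      simpa only [add_im, ofReal_im, mul_im, ofReal_re, I_im, I_re, mul_one, mul_zero,
        add_zero, zero_add] using (hpos n).le
    have hto : ∀ x : ℝ, Tendsto (fun n : ℕ => (x + (1 / ((n : ℝ) + 1) : ℝ) * I : ℂ)) atTop
        (𝓝 x) := by
      intro x
      have h3 : Continuous fun ε : ℝ => (x + ε * I : ℂ) := by fun_prop
      have h4 := (h3.tendsto 0).comp tendsto_one_div_add_atTop_nhds_zero_nat
      rw [ofReal_zero, zero_mul, add_zero] at h4
      exact h4
    have l1 := tendsto_integral_of_dominated_convergence (fun x => ‖L‖ * ‖g x * φ x‖)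
      (fun n : ℕ => hmeas (1 / ((n : ℝ) + 1))) ((hg φ).norm.const_mul ‖L‖)
      (fun n => by filter_upwards [hbd] with x hx using hx _ (hpos n).le)
      (f := fun x : ℝ => L (-I * deriv Φ x) * φ x) (by
        filter_upwards [hx] with x hx
        have hcd : ContinuousAt (deriv Φ) x :=
          (Complex.analyticAt_iff_eventually_differentiableAt.2 hx).deriv.continuousAt
        exact ((L.continuous.tendsto _).comp ((hcd.tendsto.comp (hto x)).const_mul (-I))).mul_const
          _)
    have l2 := tendsto_integral_of_dominated_convergence
      (F := fun (n : ℕ) (x : ℝ) => L (Φ (x + (1 / ((n : ℝ) + 1) : ℝ) * I)) * halfLaplacian φ x)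
      (fun x => ‖L‖ * C * ‖halfLaplacian φ x‖)
      (fun n : ℕ => (hline _ (hpos n).le).aestronglyMeasurable.mul hψ.aestronglyMeasurable)
      (hψ.norm.const_mul _)
      (fun n => .of_forall fun x => by
        rw [norm_mul]
        gcongr
        exact hLC _ (him n x))
      (f := fun x : ℝ => L (Φ x) * halfLaplacian φ x) (.of_forall fun x => by
        have h1 := (hc x (by simp)).tendsto.comp (tendsto_nhdsWithin_iff.2 ⟨hto x,
          .of_forall fun n => him n x⟩)
        exact ((L.continuous.tendsto _).comp h1).mul_const _)
    refine tendsto_nhds_unique l1 (l2.congr fun n => ?_)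
    exact (hline_eq _ (hpos n)).symm

lemma hasDistribFracLaplacian_one :
    HasDistribFracLaplacian (1 / 2) (fun _ => 1) (fun _ => 0) := by
  intro φ
  have h := integral_mul_halfLaplacian (u := fun _ => 1) (C := 1) (K := 0) measurable_const
    (by simp) (fun x s _ => by simp [secondDiff]; norm_num) φ
  refine ⟨halfLaplacian φ, hasFracLaplacianAt_schwartz φ, ?_, by simp, ?_⟩
  · simpa using integrable_halfLaplacian_schwartz φ
  · rw [h]
    have h0 : ∀ x, halfLaplacian (fun _ => 1) x = 0 := fun x => by
      have : ∀ s : ℝ, secondDiff (fun _ => 1) x s = 0 := fun s => by simp [secondDiff]; norm_num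
      simp [halfLaplacian, this]
    simp [h0]

lemma integrable_inv_sqrt_abs_sub_mul (c : ℝ) (φ : SchwartzMap ℝ ℝ) :
    Integrable fun x => (√|x - c|)⁻¹ * φ x := by
  obtain ⟨A, hA, -, -⟩ := schwartz_bounds φ
  have hm : AEStronglyMeasurable fun x : ℝ => (√|x - c|)⁻¹ :=
    (by fun_prop : Measurable fun x : ℝ => (√|x - c|)⁻¹).aestronglyMeasurable
  have h1 : Integrable (fun x => sqrtKernel (x - c)) := integrable_sqrtKernel.comp_sub_right c
  have h2 : Integrable fun x => sqrtKernel (x - c) * A + |φ x| :=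
    (h1.mul_const A).add φ.integrable.abs
  refine h2.mono' (hm.mul φ.continuous.aestronglyMeasurable) (.of_forall fun x => ?_)
  have hA0 : 0 ≤ A := (abs_nonneg _).trans (hA x)
  have h3 : 0 ≤ 2 * (1 + (x - c) ^ 2)⁻¹ := by positivity
  have h4 : 0 ≤ (√|x - c|)⁻¹ := by positivity
  rw [norm_mul, Real.norm_of_nonneg h4, Real.norm_eq_abs, sqrtKernel]
  by_cases h : x - c ∈ Icc (-1 : ℝ) 1
  · rw [indicator_of_mem h]
    have := mul_le_mul_of_nonneg_left (hA x) h4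
    nlinarith [abs_nonneg (φ x)]
  · rw [indicator_of_notMem h]
    have h5 : 1 ≤ |x - c| := by
      by_contra hlt
      exact h (abs_le.1 (not_le.1 hlt).le)
    have h6 : (√|x - c|)⁻¹ ≤ 1 := inv_le_one_of_one_le₀ (Real.one_le_sqrt.2 h5)
    nlinarith [abs_nonneg (φ x)]

/-! ### The generating functions on the interval `[a, b]` -/

lemma norm_pow_sub_pow_le {z w : ℂ} (hz : ‖z‖ ≤ 1) (hw : ‖w‖ ≤ 1) (n : ℕ) :
    ‖z ^ n - w ^ n‖ ≤ n * ‖z - w‖ := by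
  induction n with
  | zero => simp
  | succ n ih =>
    have e : z ^ (n + 1) - w ^ (n + 1) = z ^ n * (z - w) + (z ^ n - w ^ n) * w := by ring
    rw [e]
    refine (norm_add_le _ _).trans ?_
    rw [norm_mul, norm_mul, norm_pow]
    have h1 : ‖z‖ ^ n * ‖z - w‖ ≤ 1 * ‖z - w‖ := by
      gcongr
      exact pow_le_one₀ (norm_nonneg _) hz
    have h2 : ‖z ^ n - w ^ n‖ * ‖w‖ ≤ n * ‖z - w‖ * 1 := by gcongr
    push_cast
    linarith

/-- The complex extension of `toRef`, an affine automorphism of the upper half-plane. -/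
noncomputable def toRefC (a b : ℝ) (z : ℂ) : ℂ :=
  ((2 / (b - a) : ℝ) : ℂ) * (z - ((a + b) / 2 : ℝ))

/-- The holomorphic function with boundary values `extT (k + 1) - i wtW k` on the real line. -/
noncomputable def joukPow (a b : ℝ) (k : ℕ) (z : ℂ) : ℂ := jouk (toRefC a b z) ^ (k + 1)

lemma toRefC_ofReal (a b x : ℝ) : toRefC a b x = (toRef a b x : ℝ) := by
  simp [toRefC, toRef]

lemma toRefC_im (a b : ℝ) (z : ℂ) : (toRefC a b z).im = 2 / (b - a) * z.im := by
  simp only [toRefC, mul_im, sub_re, sub_im, ofReal_re, ofReal_im, zero_mul, sub_zero, add_zero]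

lemma toRefC_sub (a b : ℝ) (z w : ℂ) :
    toRefC a b z - toRefC a b w = ((2 / (b - a) : ℝ) : ℂ) * (z - w) := by
  unfold toRefC; ring

lemma hasDerivAt_toRefC (a b : ℝ) (z : ℂ) :
    HasDerivAt (toRefC a b) ((2 / (b - a) : ℝ) : ℂ) z := by
  have h := ((hasDerivAt_id z).sub_const (((a + b) / 2 : ℝ) : ℂ)).const_mul
    ((2 / (b - a) : ℝ) : ℂ)
  rw [mul_one] at h
  exact h

lemma joukPow_ofReal_re (a b : ℝ) (k : ℕ) (x : ℝ) :
    (joukPow a b k x).re = extT (k + 1) (toRef a b x) := by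
  rw [joukPow, toRefC_ofReal, jouk_pow_ofReal_re]

lemma joukPow_ofReal_im (a b : ℝ) (k : ℕ) (x : ℝ) :
    (joukPow a b k x).im = -wtW k (toRef a b x) := by
  rw [joukPow, toRefC_ofReal, jouk_pow_ofReal_im]

variable {a b : ℝ}

lemma toRefC_left (hab : a < b) : toRefC a b a = -1 := by
  have : b - a ≠ 0 := by linarith
  rw [toRefC_ofReal, toRef, show 2 / (b - a) * (a - (a + b) / 2) = -1 by field_simp; ring]
  simp

lemma toRefC_right (hab : a < b) : toRefC a b b = 1 := by
  have : b - a ≠ 0 := by linarith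
  rw [toRefC_ofReal, toRef, show 2 / (b - a) * (b - (a + b) / 2) = 1 by field_simp; ring]
  simp

lemma toRefC_sub_one (hab : a < b) (z : ℂ) :
    toRefC a b z - 1 = ((2 / (b - a) : ℝ) : ℂ) * (z - b) := by
  rw [← toRefC_right hab, toRefC_sub]

lemma toRefC_add_one (hab : a < b) (z : ℂ) :
    toRefC a b z + 1 = ((2 / (b - a) : ℝ) : ℂ) * (z - a) := by
  rw [← toRefC_sub, toRefC_left hab, sub_neg_eq_add]

lemma two_div_sub_pos (hab : a < b) : 0 < 2 / (b - a) := div_pos two_pos (sub_pos.2 hab)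

lemma toRefC_im_nonneg (hab : a < b) {z : ℂ} (hz : 0 ≤ z.im) : 0 ≤ (toRefC a b z).im := by
  rw [toRefC_im]
  exact mul_nonneg (two_div_sub_pos hab).le hz

lemma toRefC_ne_one (hab : a < b) {z : ℂ} (hz : z ≠ b) : toRefC a b z ≠ 1 := by
  rw [← sub_ne_zero, toRefC_sub_one hab]
  exact mul_ne_zero (ofReal_ne_zero.2 (two_div_sub_pos hab).ne') (sub_ne_zero.2 hz)

lemma toRefC_ne_neg_one (hab : a < b) {z : ℂ} (hz : z ≠ a) : toRefC a b z ≠ -1 := by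
  rw [ne_eq, ← add_eq_zero_iff_eq_neg, toRefC_add_one hab]
  exact mul_ne_zero (ofReal_ne_zero.2 (two_div_sub_pos hab).ne') (sub_ne_zero.2 hz)

lemma hasDerivAt_joukPow (hab : a < b) (k : ℕ) {z : ℂ} (hz : 0 ≤ z.im) (ha : z ≠ a)
    (hb : z ≠ b) :
    HasDerivAt (joukPow a b k) (((k + 1) * (2 / (b - a)) : ℝ) * (jouk (toRefC a b z) ^ k *
      (-jouk (toRefC a b z) / joukRoot (toRefC a b z)))) z := by
  have h1 := (hasDerivAt_jouk (toRefC_im_nonneg hab hz) (toRefC_ne_one hab hb)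
    (toRefC_ne_neg_one hab ha)).comp z (hasDerivAt_toRefC a b z)
  refine (h1.pow (k + 1)).congr_deriv ?_
  simp only [Function.comp_apply, add_tsub_cancel_right]
  push_cast
  ring

lemma deriv_joukPow_ofReal (hab : a < b) (k : ℕ) {x : ℝ} (ha : x ≠ a) (hb : x ≠ b) :
    deriv (joukPow a b k) x = ((k + 1) * (2 / (b - a)) : ℝ) *
      (⟨extU (k + 2) (toRef a b x), wtV (k + 1) (toRef a b x)⟩ : ℂ) := by
  have ha' : (x : ℂ) ≠ a := by exact_mod_cast ha
  have hb' : (x : ℂ) ≠ b := by exact_mod_cast hb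
  have h1 := toRefC_ne_one hab hb'
  have h2 := toRefC_ne_neg_one hab ha'
  rw [(hasDerivAt_joukPow hab k (by simp) ha' hb').deriv]
  rw [toRefC_ofReal] at h1 h2 ⊢
  rw [deriv_jouk_pow_ofReal (by exact_mod_cast h1) (by exact_mod_cast h2)]

lemma differentiableOn_joukPow (hab : a < b) (k : ℕ) :
    DifferentiableOn ℂ (joukPow a b k) {z | 0 < z.im} := fun z hz => by
  refine (hasDerivAt_joukPow hab k (le_of_lt hz) ?_ ?_).differentiableAt.differentiableWithinAt <;>
  · rintro rfl
    simp at hz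

lemma eventually_differentiableAt_rotSqrt {w : ℂ} (hw : 0 ≤ w.im) (h0 : w ≠ 0) :
    ∀ᶠ z in 𝓝 w, DifferentiableAt ℂ rotSqrt z := by
  have hc : ContinuousAt (fun z : ℂ => -I * z) w := by fun_prop
  filter_upwards [hc.eventually (isOpen_slitPlane.mem_nhds (neg_I_mul_mem_slitPlane hw h0))]
    with z hz
  exact (differentiableAt_sqrt hz).comp z (by fun_prop)

lemma eventually_differentiableAt_joukPow (hab : a < b) (k : ℕ) {x : ℝ} (ha : x ≠ a) (hb : x ≠ b) :
    ∀ᶠ z in 𝓝 (x : ℂ), DifferentiableAt ℂ (joukPow a b k) z := by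
  have him := toRefC_im_nonneg hab (z := x) (by simp)
  have h1 := sub_ne_zero.2 (toRefC_ne_one hab (z := x) (by exact_mod_cast hb))
  have h2 : toRefC a b x + 1 ≠ 0 := fun h =>
    toRefC_ne_neg_one hab (z := x) (by exact_mod_cast ha) (eq_neg_of_add_eq_zero_left h)
  have hr : ∀ z, DifferentiableAt ℂ (toRefC a b) z := fun z =>
    (hasDerivAt_toRefC a b z).differentiableAt
  have c1 : ContinuousAt (fun z => toRefC a b z - 1) x := (hr _).continuousAt.sub_const _
  have c2 : ContinuousAt (fun z => toRefC a b z + 1) x := (hr _).continuousAt.add_const _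
  filter_upwards [c1.eventually (eventually_differentiableAt_rotSqrt (by simpa using him) h1),
    c2.eventually (eventually_differentiableAt_rotSqrt (by simpa using him) h2)] with z d1 d2
  have e1 : DifferentiableAt ℂ (fun z => rotSqrt (toRefC a b z - 1)) z :=
    DifferentiableAt.comp (g := rotSqrt) z d1 ((hr z).sub_const 1)
  have e2 : DifferentiableAt ℂ (fun z => rotSqrt (toRefC a b z + 1)) z :=
    DifferentiableAt.comp (g := rotSqrt) z d2 ((hr z).add_const 1)
  exact ((hr z).sub ((e1.mul e2).const_mul I)).pow (k + 1)

lemma norm_joukPow_le_norm_jouk (hab : a < b) (k : ℕ) {z : ℂ} (hz : 0 ≤ z.im) :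
    ‖joukPow a b k z‖ ≤ ‖jouk (toRefC a b z)‖ := by
  rw [joukPow, norm_pow]
  exact pow_le_of_le_one (norm_nonneg _) (norm_jouk_le_one (toRefC_im_nonneg hab hz)) (by simp)

lemma norm_joukPow_le_one (hab : a < b) (k : ℕ) {z : ℂ} (hz : 0 ≤ z.im) :
    ‖joukPow a b k z‖ ≤ 1 :=
  (norm_joukPow_le_norm_jouk hab k hz).trans (norm_jouk_le_one (toRefC_im_nonneg hab hz))

lemma norm_joukPow_mul_norm_le (hab : a < b) (k : ℕ) {z : ℂ} (hz : 0 ≤ z.im) :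
    ‖joukPow a b k z‖ * ‖z‖ ≤ (b - a) / 2 + |(a + b) / 2| := by
  have hba : 0 < b - a := sub_pos.2 hab
  have hw := toRefC_im_nonneg hab hz
  have e : z = ((b - a) / 2 : ℝ) * toRefC a b z + ((a + b) / 2 : ℝ) := by
    have : (b : ℂ) - a ≠ 0 := by exact_mod_cast hba.ne'
    unfold toRefC
    push_cast
    field_simp
    ring
  have h1 : ‖z‖ ≤ (b - a) / 2 * ‖toRefC a b z‖ + |(a + b) / 2| := by
    conv_lhs => rw [e]
    refine (norm_add_le _ _).trans ?_
    rw [norm_mul, norm_real, norm_real, Real.norm_of_nonneg (by positivity), Real.norm_eq_abs]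
  calc _ ≤ ‖jouk (toRefC a b z)‖ * ((b - a) / 2 * ‖toRefC a b z‖ + |(a + b) / 2|) :=
        mul_le_mul (norm_joukPow_le_norm_jouk hab k hz) h1 (norm_nonneg _) (norm_nonneg _)
    _ = (b - a) / 2 * (‖jouk (toRefC a b z)‖ * ‖toRefC a b z‖) +
        ‖jouk (toRefC a b z)‖ * |(a + b) / 2| := by ring
    _ ≤ (b - a) / 2 * 1 + 1 * |(a + b) / 2| := by
        gcongr
        · exact norm_jouk_mul_norm_le hw
        · exact norm_jouk_le_one hw
    _ = _ := by ring

lemma norm_joukPow_sub_le (hab : a < b) (k : ℕ) {z w : ℂ} (hz : 0 ≤ z.im) (hw : 0 ≤ w.im) :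
    ‖joukPow a b k z - joukPow a b k w‖ ≤ (k + 1) * 4 * √(2 / (b - a)) * √‖z - w‖ := by
  have hz' := toRefC_im_nonneg hab hz
  have hw' := toRefC_im_nonneg hab hw
  have hc := two_div_sub_pos hab
  have h := norm_pow_sub_pow_le (norm_jouk_le_one hz') (norm_jouk_le_one hw') (k + 1)
  have h2 := norm_jouk_sub_le hz' hw'
  rw [toRefC_sub, norm_mul, norm_real, Real.norm_of_nonneg hc.le, Real.sqrt_mul hc.le] at h2
  calc _ ≤ ((k + 1 : ℕ) : ℝ) * (4 * (√(2 / (b - a)) * √‖z - w‖)) :=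
        h.trans (by gcongr)
    _ = _ := by push_cast; ring

lemma continuousOn_joukPow (hab : a < b) (k : ℕ) :
    ContinuousOn (joukPow a b k) {z | 0 ≤ z.im} := by
  refine (continuousOn_jouk.comp (fun z _ => ?_) fun z hz => toRefC_im_nonneg hab hz).pow (k + 1)
  exact (hasDerivAt_toRefC a b z).continuousAt.continuousWithinAt

/-- The derivative `-(k + 1) jouk ^ (k + 1) / √(z² - 1)` has inverse square root singularities at
the endpoints, uniformly in the height above the real line. -/
lemma norm_deriv_joukPow_le (hab : a < b) (k : ℕ) {x : ℝ} (ha : x ≠ a) (hb : x ≠ b) {ε : ℝ}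
    (hε : 0 ≤ ε) : ‖deriv (joukPow a b k) (x + ε * I)‖ ≤
      (k + 1) / √(b - a) * ((√|x - a|)⁻¹ + (√|x - b|)⁻¹) := by
  have hba : 0 < b - a := sub_pos.2 hab
  have hc := two_div_sub_pos hab
  set z : ℂ := x + ε * I with hzdef
  have hre : z.re = x := by simp [hzdef]
  have him : 0 ≤ z.im := by simpa [hzdef] using hε
  have hza : z ≠ a := by
    intro h
    rw [h] at hre
    exact ha (by simpa using hre.symm)
  have hzb : z ≠ b := by
    intro h
    rw [h] at hre
    exact hb (by simpa using hre.symm)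
  have pa : 0 < |x - a| := abs_pos.2 (sub_ne_zero.2 ha)
  have pb : 0 < |x - b| := abs_pos.2 (sub_ne_zero.2 hb)
  have hw := toRefC_im_nonneg hab him
  set w := toRefC a b z with hwdef
  have hroot : 2 / (b - a) * (√|x - a| * √|x - b|) ≤ ‖joukRoot w‖ := by
    rw [← sq_le_sq₀ (by positivity) (norm_nonneg _), norm_joukRoot_sq, hwdef, toRefC_sub_one hab,
      toRefC_add_one hab, norm_mul, norm_mul, norm_real, Real.norm_of_nonneg hc.le, mul_pow, mul_pow,
      Real.sq_sqrt pa.le, Real.sq_sqrt pb.le]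
    have h1 : |x - a| ≤ ‖z - a‖ := by
      have := Complex.abs_re_le_norm (z - a)
      rwa [sub_re, hre, ofReal_re] at this
    have h2 : |x - b| ≤ ‖z - b‖ := by
      have := Complex.abs_re_le_norm (z - b)
      rwa [sub_re, hre, ofReal_re] at this
    calc (2 / (b - a)) ^ 2 * (|x - a| * |x - b|) ≤ (2 / (b - a)) ^ 2 * (‖z - a‖ * ‖z - b‖) := by
          gcongr
      _ = _ := by ring
  have hsa : 0 < √|x - a| := Real.sqrt_pos.2 pa
  have hsb : 0 < √|x - b| := Real.sqrt_pos.2 pb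
  have hsab : 0 < √(b - a) := Real.sqrt_pos.2 hba
  have hr0 : 0 < ‖joukRoot w‖ := lt_of_lt_of_le (by positivity) hroot
  -- `√(b - a) ≤ √|x - a| + √|x - b|` separates the two singularities
  have hsum : √(b - a) ≤ √|x - a| + √|x - b| := by
    rw [Real.sqrt_le_left (by positivity)]
    have h1 := abs_sub_le b x a
    rw [abs_of_pos hba, abs_sub_comm b x] at h1
    nlinarith [Real.sq_sqrt pa.le, Real.sq_sqrt pb.le]
  rw [(hasDerivAt_joukPow hab k him hza hzb).deriv]
  rw [norm_mul, norm_real, Real.norm_of_nonneg (by positivity), norm_mul, norm_pow, norm_div,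
    norm_neg]
  have hj := norm_jouk_le_one hw
  calc _ ≤ (k + 1) * (2 / (b - a)) * (1 * (1 / (2 / (b - a) * (√|x - a| * √|x - b|)))) := by
        gcongr
        exact pow_le_one₀ (norm_nonneg _) hj
    _ = (k + 1) / (√|x - a| * √|x - b|) := by field_simp
    _ = (k + 1) / √(b - a) * (√(b - a) / (√|x - a| * √|x - b|)) := by field_simp
    _ ≤ (k + 1) / √(b - a) * ((√|x - a| + √|x - b|) / (√|x - a| * √|x - b|)) := by gcongr
    _ = _ := by field_simp; ring

lemma hasHilbertTransformAt_joukPow (hab : a < b) (k : ℕ) (L : ℂ →L[ℝ] ℝ) (x : ℝ) :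
    HasHilbertTransformAt (fun t => L (joukPow a b k t)) x (L (-I * joukPow a b k x)) := by
  have hc := two_div_sub_pos hab
  have hba : 0 < b - a := sub_pos.2 hab
  have p1 : 0 ≤ (b - a) / 2 + |(a + b) / 2| := by positivity
  have p2 : 0 ≤ (k + 1) * 4 * √(2 / (b - a)) := by positivity
  refine hasHilbertTransformAt_boundary
    (C := 1 + ((b - a) / 2 + |(a + b) / 2|) + (k + 1) * 4 * √(2 / (b - a))) L
    (differentiableOn_joukPow hab k) (fun z hz => ?_) (fun z hz => ?_)
    (continuousOn_joukPow hab k) (fun z w hz hw => ?_) x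
  · linarith [norm_joukPow_le_one hab k hz]
  · linarith [norm_joukPow_mul_norm_le hab k hz]
  · refine (norm_joukPow_sub_le hab k hz hw).trans ?_
    gcongr
    linarith

lemma hasFracLaplacianAt_joukPow (hab : a < b) (k : ℕ) (L : ℂ →L[ℝ] ℝ) {x : ℝ} (ha : x ≠ a)
    (hb : x ≠ b) :
    HasFracLaplacianAt (1 / 2) (fun t => L (joukPow a b k t)) x
      (L (-I * deriv (joukPow a b k) x)) :=
  hasFracLaplacianAt_boundary L (differentiableOn_joukPow hab k)
    (fun _ hz => norm_joukPow_le_one hab k hz) (continuousOn_joukPow hab k)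
    (eventually_differentiableAt_joukPow hab k ha hb)

lemma hasDerivAt_map_joukPow (hab : a < b) (k : ℕ) (L : ℂ →L[ℝ] ℝ) {x : ℝ} (ha : x ≠ a)
    (hb : x ≠ b) :
    HasDerivAt (fun t : ℝ => L (joukPow a b k t)) (L (deriv (joukPow a b k) x)) x := by
  have h := (eventually_differentiableAt_joukPow hab k ha hb).self_of_nhds.hasDerivAt.comp_ofReal
  exact L.hasFDerivAt.comp_hasDerivAt x h

lemma hasDistribFracLaplacian_joukPow (hab : a < b) (k : ℕ) (L : ℂ →L[ℝ] ℝ) {f : ℝ → ℝ}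
    (hf : ∀ x, x ≠ a → x ≠ b → f x = L (-I * deriv (joukPow a b k) x)) :
    HasDistribFracLaplacian (1 / 2) (fun t => L (joukPow a b k t)) f := by
  have hne : ∀ c : ℝ, ∀ᵐ x : ℝ, x ≠ c := fun c => by simp [ae_iff, measure_singleton]
  refine hasDistribFracLaplacian_boundary (C := 1) L (differentiableOn_joukPow hab k)
    (fun _ hz => norm_joukPow_le_one hab k hz) (continuousOn_joukPow hab k) ?_
    (g := fun x => (k + 1) / √(b - a) * ((√|x - a|)⁻¹ + (√|x - b|)⁻¹)) ?_ ?_ ?_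
  · filter_upwards [hne a, hne b] with x ha hb
      using eventually_differentiableAt_joukPow hab k ha hb
  · filter_upwards [hne a, hne b] with x ha hb ε hε using norm_deriv_joukPow_le hab k ha hb hε
  · intro φ
    have h := ((integrable_inv_sqrt_abs_sub_mul a φ).add
      (integrable_inv_sqrt_abs_sub_mul b φ)).const_mul ((k + 1) / √(b - a))
    refine h.congr (.of_forall fun x => ?_)
    simp only [Pi.add_apply]
    ring
  · filter_upwards [hne a, hne b] with x ha hb using hf x ha hb

lemma hasHilbertTransformAt_one (x : ℝ) : HasHilbertTransformAt (fun _ => 1) x 0 := by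
  have h := hasHilbertTransformAt_of_integrableOn (u := fun _ => 1) (x := x) (C := 1)
    continuous_const (by simp) (by simp)
  simpa using h

lemma hasFracLaplacianAt_one (x : ℝ) : HasFracLaplacianAt (1 / 2) (fun _ => 1) x 0 := by
  have e : (fun s : ℝ => ((1 : ℝ) + 1 - 2 * 1) / s ^ 2) = fun _ => 0 := by funext s; norm_num
  have h := hasFracLaplacianAt_half_of_integrableOn (u := fun _ => 1) (x := x) (C := 1)
    continuous_const (by simp) (by rw [e]; simp)
  rw [e] at h
  simpa using h

/-! ### Columns of the quasimatrices -/

lemma extT_zero (x : ℝ) : extT 0 x = 1 := by simp [extT]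

/-- `W_k = (V_k - V_{k+2}) / 2`. -/
lemma wtW_eq (k : ℕ) (x : ℝ) : wtW k x = (wtV k x - wtV (k + 2) x) / 2 := by
  unfold wtW wtV
  split_ifs with h
  · have h0 : 0 < 1 - x ^ 2 := by nlinarith [sq_abs x, abs_nonneg x]
    have h1 : √(1 - x ^ 2) ≠ 0 := (Real.sqrt_pos.2 h0).ne'
    have h2 := Real.sq_sqrt h0.le
    have t := congrArg (Polynomial.eval x)
      (Polynomial.Chebyshev.one_sub_X_sq_mul_U_eq_pol_in_T ℝ (k : ℤ))
    have t2 := congrArg (Polynomial.eval x) (Polynomial.Chebyshev.T_add_two ℝ (k : ℤ))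
    simp only [Polynomial.eval_sub, Polynomial.eval_mul, Polynomial.eval_ofNat,
      Polynomial.eval_X, Polynomial.eval_one, Polynomial.eval_pow] at t t2
    push_cast
    field_simp
    rw [h2]
    linear_combination 2 * t - t2
  · norm_num

/-- A row of blocks `w i`, times a block column whose only nonzero block is `X`, in position `k`. -/
lemma sum_block_ite {p k : ℕ} (hk : k < p) (w : ℕ → Fin 2 → ℝ) (X : Matrix (Fin 2) (Fin 2) ℝ)
    (c : Fin 2) :
    ∑ i : Fin p × Fin 2, w i.1 i.2 * (if (i.1 : ℕ) = k then X else 0) i.2 c =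
      w k 0 * X 0 c + w k 1 * X 1 c := by
  rw [Fintype.sum_prod_type, Finset.sum_eq_single (⟨k, hk⟩ : Fin p)]
  · simp
  · intro i _ hi
    have : (i : ℕ) ≠ k := fun h => hi (Fin.ext h)
    simp [this]
  · simp

/-- The `i`-th two-column block of the dual sum space quasimatrix. -/
noncomputable def dualBlock (a b x : ℝ) (i : ℕ) : Fin 2 → ℝ :=
  ![wtV i (toRef a b x), extU (i + 1) (toRef a b x)]

lemma vecMul_quasiSDual_inr (x : ℝ) {n : ℕ} (k : Fin (n + 1)) (c : Fin 2)
    (A : Matrix Unit Unit ℝ) (B : Matrix (Fin (n + 3) × Fin 2) Unit ℝ)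
    (X : ℕ → ℕ → Matrix (Fin 2) (Fin 2) ℝ) :
    Matrix.vecMul (quasiSDual a b n x)
        (Matrix.fromBlocks A 0 B (ofBlocks (n + 3) (n + 1) X)) (Sum.inr (k, c)) =
      ∑ i : Fin (n + 3) × Fin 2, dualBlock a b x i.1 i.2 * X i.1 k i.2 c := by
  simp [Matrix.vecMul, dotProduct, ofBlocks, quasiSDual, dualBlock]

lemma vecMul_quasiSDual_single (x : ℝ) {n m : ℕ} (k : Fin (n + 1)) (c : Fin 2) (hm : m < n + 3)
    (A : Matrix Unit Unit ℝ) (B : Matrix (Fin (n + 3) × Fin 2) Unit ℝ)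
    (X : ℕ → ℕ → Matrix (Fin 2) (Fin 2) ℝ) (Y : Matrix (Fin 2) (Fin 2) ℝ)
    (hX : ∀ i, X i k = if i = m then Y else 0) :
    Matrix.vecMul (quasiSDual a b n x)
        (Matrix.fromBlocks A 0 B (ofBlocks (n + 3) (n + 1) X)) (Sum.inr (k, c)) =
      wtV m (toRef a b x) * Y 0 c + extU (m + 1) (toRef a b x) * Y 1 c := by
  rw [vecMul_quasiSDual_inr]
  simp only [hX]
  rw [sum_block_ite hm]
  rfl

lemma vecMul_quasiSDual_pair (x : ℝ) {n : ℕ} (k : Fin (n + 1)) (c : Fin 2)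
    (A : Matrix Unit Unit ℝ) (B : Matrix (Fin (n + 3) × Fin 2) Unit ℝ)
    (Y : Matrix (Fin 2) (Fin 2) ℝ) :
    Matrix.vecMul (quasiSDual a b n x)
        (Matrix.fromBlocks A 0 B (ofBlocks (n + 3) (n + 1) fun i k =>
          if i = k then -((1 / 2 : ℝ) • Y) else if i = k + 2 then (1 / 2 : ℝ) • Y else 0))
        (Sum.inr (k, c)) =
      (wtV (k + 2) (toRef a b x) - wtV k (toRef a b x)) / 2 * Y 0 c +
        extT (k + 1) (toRef a b x) * Y 1 c := by
  have split : ∀ i : ℕ, (if i = (k : ℕ) then -((1 / 2 : ℝ) • Y)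
      else if i = k + 2 then (1 / 2 : ℝ) • Y else 0) =
      (if i = (k : ℕ) then -((1 / 2 : ℝ) • Y) else 0) +
        (if i = k + 2 then (1 / 2 : ℝ) • Y else 0) := by
    intro i
    by_cases h : i = (k : ℕ)
    · simp [h]
    · simp [h]
  rw [vecMul_quasiSDual_inr]
  simp only [split, Matrix.add_apply, mul_add]
  rw [Finset.sum_add_distrib, sum_block_ite (by omega), sum_block_ite (by omega)]
  have hU : extU (k + 2 + 1) (toRef a b x) =
    2 * extT (k + 1) (toRef a b x) + extU (k + 1) (toRef a b x) := rfl
  simp only [dualBlock, Matrix.cons_val_zero, Matrix.cons_val_one, Matrix.neg_apply,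
    Matrix.smul_apply, smul_eq_mul]
  rw [hU]
  ring

lemma vecMul_quasiSDual_inl_zero (x : ℝ) {n : ℕ}
    (X : Matrix (Fin (n + 3) × Fin 2) (Fin (n + 1) × Fin 2) ℝ) (u : Unit) :
    Matrix.vecMul (quasiSDual a b n x) (Matrix.fromBlocks 0 0 0 X) (Sum.inl u) = 0 := by
  simp [Matrix.vecMul, dotProduct]

lemma vecMul_matE_inl (x : ℝ) (n : ℕ) (u : Unit) :
    Matrix.vecMul (quasiSDual a b n x) (matE n) (Sum.inl u) = 1 := by
  have h : ∀ i : Fin (n + 3) × Fin 2, (if (i.1 : ℕ) = 1 then (![0, 1] : Fin 2 → ℝ) i.2 else 0) =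
      (if (i.1 : ℕ) = 1 then (!![0, 0; 1, 0] : Matrix (Fin 2) (Fin 2) ℝ) else 0) i.2 0 := by
    rintro ⟨i, r⟩
    by_cases hi : (i : ℕ) = 1 <;> fin_cases r <;> simp [hi]
  have hs := sum_block_ite (p := n + 3) (k := 1) (by omega) (dualBlock a b x)
    !![0, 0; 1, 0] 0
  have hU : extU 2 (toRef a b x) = extT 0 (toRef a b x) + extU 0 (toRef a b x) := rfl
  have e : Matrix.vecMul (quasiSDual a b n x) (matE n) (Sum.inl u) =
      extU 0 (toRef a b x) * -1 + ∑ i : Fin (n + 3) × Fin 2, dualBlock a b x i.1 i.2 *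
        (if (i.1 : ℕ) = 1 then (![0, 1] : Fin 2 → ℝ) i.2 else 0) := by
    simp [Matrix.vecMul, dotProduct, matE, quasiSDual, dualBlock]
  rw [e]
  simp only [h]
  rw [hs]
  simp only [dualBlock, Matrix.cons_val_zero, Matrix.cons_val_one, Matrix.of_apply, mul_zero,
    mul_one, zero_add, Nat.reduceAdd, Matrix.cons_val', Matrix.cons_val_fin_one, hU, extT_zero]
  ring

lemma ncard_le_two {α : Type*} {s : Set α} {i j : α} (h : ∀ x ∈ s, x = i ∨ x = j) :
    s.ncard ≤ 2 :=
  (Set.ncard_le_ncard (t := {i, j}) h (Set.toFinite _)).trans ((Set.ncard_insert_le i {j}).trans (by simp))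

lemma quasiS_inl (n : ℕ) (u : Unit) (x : ℝ) : quasiS a b n x (Sum.inl u) = 1 := by
  simp [quasiS, extT_zero]

lemma quasiS_inr_zero (n : ℕ) (k : Fin (n + 1)) (x : ℝ) :
    quasiS a b n x (Sum.inr (k, 0)) = (-imCLM) (joukPow a b k x) := by
  simp [quasiS, joukPow_ofReal_im]

lemma quasiS_inr_one (n : ℕ) (k : Fin (n + 1)) (x : ℝ) :
    quasiS a b n x (Sum.inr (k, 1)) = reCLM (joukPow a b k x) := by
  simp [quasiS, joukPow_ofReal_re]

/-- Every column of the sum space quasimatrix is constant, or consists of the boundary values of the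
real part or of minus the imaginary part of some `joukPow a b k`. -/
lemma quasiS_induction {n : ℕ} {P : BlockIdx (n + 1) → (ℝ → ℝ) → Prop}
    (h0 : P (Sum.inl ()) fun _ => 1)
    (h1 : ∀ k : Fin (n + 1), P (Sum.inr (k, 0)) fun t => (-imCLM) (joukPow a b k t))
    (h2 : ∀ k : Fin (n + 1), P (Sum.inr (k, 1)) fun t => reCLM (joukPow a b k t))
    (j : BlockIdx (n + 1)) : P j fun t => quasiS a b n t j := by
  rcases j with u | ⟨k, c⟩
  · simpa only [quasiS_inl] using h0
  · fin_cases c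
    · simpa only [Fin.zero_eta, quasiS_inr_zero] using h1 k
    · simpa only [Fin.mk_one, quasiS_inr_one] using h2 k

lemma neg_I_mul_deriv_joukPow_re (hab : a < b) (k : ℕ) {x : ℝ} (ha : x ≠ a) (hb : x ≠ b) :
    reCLM (-I * deriv (joukPow a b k) x) =
      2 * ((k : ℝ) + 1) / (b - a) * wtV (k + 1) (toRef a b x) := by
  rw [deriv_joukPow_ofReal hab k ha hb]
  simp only [reCLM_apply, mul_re, neg_re, neg_im, I_re, I_im, mul_im, ofReal_re, ofReal_im]
  ring

lemma neg_I_mul_deriv_joukPow_im (hab : a < b) (k : ℕ) {x : ℝ} (ha : x ≠ a) (hb : x ≠ b) :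
    (-imCLM) (-I * deriv (joukPow a b k) x) =
      2 * ((k : ℝ) + 1) / (b - a) * extU (k + 2) (toRef a b x) := by
  rw [deriv_joukPow_ofReal hab k ha hb]
  simp only [neg_apply, imCLM_apply, mul_re, neg_re, neg_im, I_re, I_im, mul_im,
    ofReal_re, ofReal_im]
  ring

lemma vecMul_matH_inl (x : ℝ) (n : ℕ) (u : Unit) :
    Matrix.vecMul (quasiSDual a b n x) (matH n) (Sum.inl u) = 0 :=
  vecMul_quasiSDual_inl_zero x _ u

lemma vecMul_matH_inr_zero (x : ℝ) {n : ℕ} (k : Fin (n + 1)) :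
    Matrix.vecMul (quasiSDual a b n x) (matH n) (Sum.inr (k, 0)) =
      extT (k + 1) (toRef a b x) := by
  rw [matH, vecMul_quasiSDual_pair]
  simp [matM]

lemma vecMul_matH_inr_one (x : ℝ) {n : ℕ} (k : Fin (n + 1)) :
    Matrix.vecMul (quasiSDual a b n x) (matH n) (Sum.inr (k, 1)) = -wtW k (toRef a b x) := by
  rw [matH, vecMul_quasiSDual_pair, wtW_eq]
  simp [matM]
  ring

lemma vecMul_matD_inl (x : ℝ) (n : ℕ) (u : Unit) :
    Matrix.vecMul (quasiSDual a b n x) (matD a b n) (Sum.inl u) = 0 :=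
  vecMul_quasiSDual_inl_zero x _ u

lemma vecMul_matD_inr_zero (x : ℝ) {n : ℕ} (k : Fin (n + 1)) :
    Matrix.vecMul (quasiSDual a b n x) (matD a b n) (Sum.inr (k, 0)) =
      -(2 * ((k : ℝ) + 1) / (b - a) * wtV (k + 1) (toRef a b x)) := by
  rw [matD, vecMul_quasiSDual_single x k 0 (m := k + 1) (by omega) _ _ _ _ fun i => rfl]
  simp [matN]
  ring

lemma vecMul_matD_inr_one (x : ℝ) {n : ℕ} (k : Fin (n + 1)) :
    Matrix.vecMul (quasiSDual a b n x) (matD a b n) (Sum.inr (k, 1)) =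
      2 * ((k : ℝ) + 1) / (b - a) * extU (k + 2) (toRef a b x) := by
  rw [matD, vecMul_quasiSDual_single x k 1 (m := k + 1) (by omega) _ _ _ _ fun i => rfl]
  simp [matN]
  ring

lemma vecMul_matA_inl (x : ℝ) (n : ℕ) (u : Unit) :
    Matrix.vecMul (quasiSDual a b n x) (matA a b n) (Sum.inl u) = 0 :=
  vecMul_quasiSDual_inl_zero x _ u

lemma vecMul_matA_inr_zero (x : ℝ) {n : ℕ} (k : Fin (n + 1)) :
    Matrix.vecMul (quasiSDual a b n x) (matA a b n) (Sum.inr (k, 0)) =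
      2 * ((k : ℝ) + 1) / (b - a) * extU (k + 2) (toRef a b x) := by
  rw [matA, vecMul_quasiSDual_single x k 0 (m := k + 1) (by omega) _ _ _ _ fun i => rfl]
  simp [matM]
  ring

lemma vecMul_matA_inr_one (x : ℝ) {n : ℕ} (k : Fin (n + 1)) :
    Matrix.vecMul (quasiSDual a b n x) (matA a b n) (Sum.inr (k, 1)) =
      2 * ((k : ℝ) + 1) / (b - a) * wtV (k + 1) (toRef a b x) := by
  rw [matA, vecMul_quasiSDual_single x k 1 (m := k + 1) (by omega) _ _ _ _ fun i => rfl]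
  simp [matM]
  ring

lemma quasiS_eq_vecMul_matE (n : ℕ) (x : ℝ) :
    quasiS a b n x = Matrix.vecMul (quasiSDual a b n x) (matE n) := by
  funext j
  rcases j with u | ⟨k, c⟩
  · rw [quasiS_inl, vecMul_matE_inl]
  · rw [matE, vecMul_quasiSDual_pair]
    fin_cases c
    · simp [quasiS, matN, wtW_eq]
      ring
    · simp [quasiS, matN]

/-! ### Sparsity -/

/-- `σ c` is the only row in which column `c` of the block `Y` may have a nonzero entry. -/
lemma isSparseBanded_pair {p q : ℕ} {A : Matrix Unit Unit ℝ} {B : Matrix (Fin p × Fin 2) Unit ℝ}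
    {Y : Matrix (Fin 2) (Fin 2) ℝ} {i₀ j₀ : BlockIdx p}
    (hAB : ∀ i, Matrix.fromBlocks A (0 : Matrix Unit (Fin q × Fin 2) ℝ) B 0 i (Sum.inl ()) ≠ 0 →
      i = i₀ ∨ i = j₀) {σ : Fin 2 → Fin 2}
    (hY : ∀ r c, Y r c ≠ 0 → r = σ c) (h2 : ∀ k : Fin q, (k : ℕ) + 2 < p) :
    IsSparseBanded (Matrix.fromBlocks A 0 B (ofBlocks p q fun i k =>
      if i = k then -((1 / 2 : ℝ) • Y) else if i = k + 2 then (1 / 2 : ℝ) • Y else 0)) := by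
  have key : ∀ (i : Fin p) (k : Fin q) (r c : Fin 2), ofBlocks p q (fun i k =>
      if i = k then -((1 / 2 : ℝ) • Y) else if i = k + 2 then (1 / 2 : ℝ) • Y else 0)
      (i, r) (k, c) ≠ 0 → r = σ c ∧ ((i : ℕ) = k ∨ (i : ℕ) = k + 2) := by
    intro i k r c h
    simp only [ofBlocks, Matrix.of_apply] at h
    split_ifs at h with h1 h2
    · exact ⟨hY r c fun h0 => h (by simp [h0]), Or.inl h1⟩
    · exact ⟨hY r c fun h0 => h (by simp [h0]), Or.inr h2⟩
    · simp at h
  refine ⟨?_, fun i k r c h => ?_⟩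
  · rintro (u | ⟨k, c⟩)
    · refine ncard_le_two (i := i₀) (j := j₀) fun i hi => hAB i ?_
      rcases i with i | i <;> exact hi
    · refine ncard_le_two (i := Sum.inr (⟨k, by have := h2 k; omega⟩, σ c))
        (j := Sum.inr (⟨k + 2, h2 k⟩, σ c)) ?_
      rintro (u | ⟨i, r⟩) hi
      · exact absurd rfl hi
      · obtain ⟨rfl, h | h⟩ := key i k r c hi
        · left; congr 2; exact Fin.ext h
        · right; congr 2; exact Fin.ext h
  · obtain ⟨-, h⟩ := key i k r c h
    omega

lemma isSparseBanded_single {p q : ℕ} {s : ℕ → ℝ} {Y : Matrix (Fin 2) (Fin 2) ℝ}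
    {σ : Fin 2 → Fin 2} (hY : ∀ r c, Y r c ≠ 0 → r = σ c) (h1 : ∀ k : Fin q, (k : ℕ) + 1 < p) :
    IsSparseBanded (Matrix.fromBlocks 0 0 0 (ofBlocks p q fun i k =>
      if i = k + 1 then s k • Y else 0)) := by
  have key : ∀ (i : Fin p) (k : Fin q) (r c : Fin 2), ofBlocks p q (fun i k =>
      if i = k + 1 then s k • Y else 0) (i, r) (k, c) ≠ 0 → r = σ c ∧ (i : ℕ) = k + 1 := by
    intro i k r c h
    simp only [ofBlocks, Matrix.of_apply] at h
    split_ifs at h with h1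
    · exact ⟨hY r c fun h0 => h (by simp [h0]), h1⟩
    · simp at h
  refine ⟨?_, fun i k r c h => ?_⟩
  · rintro (u | ⟨k, c⟩)
    · have : {i : BlockIdx p | Matrix.fromBlocks 0 0 0 (ofBlocks p q fun i k =>
          if i = k + 1 then s k • Y else 0) i (Sum.inl u) ≠ 0} = ∅ := by
        ext i
        rcases i with i | i <;> simp
      rw [this]
      simp
    · refine ncard_le_two (i := Sum.inr (⟨k + 1, h1 k⟩, σ c))
        (j := Sum.inr (⟨k + 1, h1 k⟩, σ c)) ?_
      rintro (u | ⟨i, r⟩) hi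
      · exact absurd rfl hi
      · obtain ⟨rfl, h⟩ := key i k r c hi
        left; congr 2; exact Fin.ext h
  · obtain ⟨-, h⟩ := key i k r c h
    omega

lemma matN_ne_zero (r c : Fin 2) (h : matN r c ≠ 0) : r = id c := by
  fin_cases r <;> fin_cases c <;> simp_all [matN]

lemma matM_ne_zero (r c : Fin 2) (h : matM r c ≠ 0) : r = 1 - c := by
  fin_cases r <;> fin_cases c <;> simp_all [matM]

lemma isSparseBanded_matE (n : ℕ) : IsSparseBanded (matE n) := by
  refine isSparseBanded_pair (i₀ := Sum.inl ()) (j₀ := Sum.inr (1, 1)) ?_ matN_ne_zero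
    (fun k => by omega)
  rintro (u | ⟨i, r⟩) h
  · left; rfl
  · right
    simp only [Matrix.fromBlocks_apply₂₁, Matrix.of_apply] at h
    split_ifs at h with h1
    · have hi : i = 1 := Fin.ext (by simpa using h1)
      fin_cases r
      · simp at h
      · rw [hi]; rfl
    · exact absurd rfl h

lemma isSparseBanded_matH (n : ℕ) : IsSparseBanded (matH n) := by
  refine isSparseBanded_pair (i₀ := Sum.inl ()) (j₀ := Sum.inl ()) ?_ matM_ne_zero
    (fun k => by omega)
  rintro (u | i) h
  · left; rfl
  · exact absurd rfl h

lemma isSparseBanded_matD (a b : ℝ) (n : ℕ) : IsSparseBanded (matD a b n) :=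
  isSparseBanded_single (s := fun k => 2 * ((k : ℝ) + 1) / (b - a)) matN_ne_zero
    (fun k => by omega)

lemma isSparseBanded_matA (a b : ℝ) (n : ℕ) : IsSparseBanded (matA a b n) :=
  isSparseBanded_single (s := fun k => 2 * ((k : ℝ) + 1) / (b - a)) matM_ne_zero
    (fun k => by omega)

end SumSpace

theorem mainTheorem4 (a b : ℝ) (hab : a < b) (n : ℕ) :
    (∀ x : ℝ, SumSpace.quasiS a b n x =
      Matrix.vecMul (SumSpace.quasiSDual a b n x) (SumSpace.matE n)) ∧
    (∀ (x : ℝ) (j : SumSpace.BlockIdx (n + 1)),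
      SumSpace.HasHilbertTransformAt (fun t => SumSpace.quasiS a b n t j) x
        (Matrix.vecMul (SumSpace.quasiSDual a b n x) (SumSpace.matH n) j)) ∧
    (∀ x : ℝ, x ≠ a → x ≠ b → ∀ j : SumSpace.BlockIdx (n + 1),
      HasDerivAt (fun t => SumSpace.quasiS a b n t j)
        (Matrix.vecMul (SumSpace.quasiSDual a b n x) (SumSpace.matD a b n) j) x) ∧
    (∀ x : ℝ, x ≠ a → x ≠ b → ∀ j : SumSpace.BlockIdx (n + 1),
      SumSpace.HasFracLaplacianAt (1 / 2) (fun t => SumSpace.quasiS a b n t j) x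
        (Matrix.vecMul (SumSpace.quasiSDual a b n x) (SumSpace.matA a b n) j)) ∧
    (∀ j : SumSpace.BlockIdx (n + 1),
      SumSpace.HasDistribFracLaplacian (1 / 2) (fun t => SumSpace.quasiS a b n t j)
        (fun t => Matrix.vecMul (SumSpace.quasiSDual a b n t) (SumSpace.matA a b n) j)) ∧
    SumSpace.IsSparseBanded (SumSpace.matE n) ∧
    SumSpace.IsSparseBanded (SumSpace.matH n) ∧
    SumSpace.IsSparseBanded (SumSpace.matD a b n) ∧
    SumSpace.IsSparseBanded (SumSpace.matA a b n) := by
  open SumSpace Complex in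
  refine ⟨quasiS_eq_vecMul_matE n, fun x => ?_, fun x ha hb => ?_, fun x ha hb => ?_, ?_,
    isSparseBanded_matE n, isSparseBanded_matH n, isSparseBanded_matD a b n,
    isSparseBanded_matA a b n⟩
  · refine quasiS_induction (P := fun j u => HasHilbertTransformAt u x
      (Matrix.vecMul (quasiSDual a b n x) (matH n) j)) ?_ (fun k => ?_) (fun k => ?_)
    · rw [vecMul_matH_inl]
      exact hasHilbertTransformAt_one x
    · convert hasHilbertTransformAt_joukPow hab k (-imCLM) x using 1
      simp [vecMul_matH_inr_zero, joukPow_ofReal_re]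
    · convert hasHilbertTransformAt_joukPow hab k reCLM x using 1
      simp [vecMul_matH_inr_one, joukPow_ofReal_im]
  · refine quasiS_induction (P := fun j u => HasDerivAt u
      (Matrix.vecMul (quasiSDual a b n x) (matD a b n) j) x) ?_ (fun k => ?_) (fun k => ?_)
    · rw [vecMul_matD_inl]
      exact hasDerivAt_const x 1
    · convert hasDerivAt_map_joukPow hab k (-imCLM) ha hb using 1
      rw [vecMul_matD_inr_zero, deriv_joukPow_ofReal hab k ha hb]
      simp only [neg_apply, imCLM_apply, mul_im, ofReal_re, ofReal_im]
      ring
    · convert hasDerivAt_map_joukPow hab k reCLM ha hb using 1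
      rw [vecMul_matD_inr_one, deriv_joukPow_ofReal hab k ha hb]
      simp only [reCLM_apply, mul_re, ofReal_re, ofReal_im]
      ring
  · refine quasiS_induction (P := fun j u => HasFracLaplacianAt (1 / 2) u x
      (Matrix.vecMul (quasiSDual a b n x) (matA a b n) j)) ?_ (fun k => ?_) (fun k => ?_)
    · rw [vecMul_matA_inl]
      exact hasFracLaplacianAt_one x
    · rw [vecMul_matA_inr_zero, ← neg_I_mul_deriv_joukPow_im hab k ha hb]
      exact hasFracLaplacianAt_joukPow hab k (-imCLM) ha hb
    · rw [vecMul_matA_inr_one, ← neg_I_mul_deriv_joukPow_re hab k ha hb]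
      exact hasFracLaplacianAt_joukPow hab k reCLM ha hb
  · refine quasiS_induction (P := fun j u => HasDistribFracLaplacian (1 / 2) u
      (fun t => Matrix.vecMul (quasiSDual a b n t) (matA a b n) j)) ?_ (fun k => ?_) (fun k => ?_)
    · simp only [vecMul_matA_inl]
      exact hasDistribFracLaplacian_one
    · refine hasDistribFracLaplacian_joukPow hab k (-imCLM) fun x ha hb => ?_
      rw [vecMul_matA_inr_zero, neg_I_mul_deriv_joukPow_im hab k ha hb]
    · refine hasDistribFracLaplacian_joukPow hab k reCLM fun x ha hb => ?_
      rw [vecMul_matA_inr_one, neg_I_mul_deriv_joukPow_re hab k ha hb]
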